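/- Let $X$ be a finite connected quandle (a set with an operation $*$ such that every map $x\mapsto x*b$ is a bijection, $(a*b)*c=(a*c)*(b*c)$ and $a*a=a$; connected means that the group generated by the maps $x\mapsto x*b$ acts transitively on $X$). Let $B^QX$ be the quandle space of $X$: it is obtained from cubes $[0,1]^n$ labelled by $(x_1,\dots,x_n)\in X^n$, $n\ge 0$, where the face $t_i=0$ is glued to the cube $(x_1,\dots,\widehat{x_i},\dots,x_n)$ and the face $t_i=1$ to the cube $(x_1*x_i,\dots,x_{i-1}*x_i,x_{i+1},\dots,x_n)$, by attaching, whenever $x_i=x_{i+1}$, a cell $D^3\times[0,1]^{n-2}$ that fills the sphere into which the $(t_i,t_{i+1})$-square is folded (for $n=2$: a 3-cell for each $(b,b)$). Let $BX_Q^X$ be the action quandle space, built in the same way from cubes $[0,1]^n$ labelled by $(r;x_1,\dots,x_n)\in X\times X^n$, with $r$ kept on the faces $t_i=0$ and replaced by $r*x_i$ on the faces $t_i=1$ (for $n=2$ the extra cells are 3-cells for the labels $(r;b,b)$). Let $\tilde p:BX_Q^X\to B^QX$ forget the first entry of the labels. The space $BX_Q^X$ is path-connected, $\tilde p$ is a covering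 map, and for every $r_0\in X$ it induces an isomorphism $\tilde p_*:\pi_2(BX_Q^X,r_0)\to\pi_2(B^QX)$, by which these groups are identified. Let $L$ be an oriented link with diagram $D$ in $[0,1]^2$, and give every strand its left normal. A coloring $\mathcal C$ of $D$ assigns elements of $X$ to the arcs such that, at a crossing with over arc $b$, the under arcs are $a$ and $a*b$, in the direction of the normal of the over arc. A shadow coloring $\tilde{\mathcal C}$ also assigns elements of $X$ to the regions such that crossing an arc of color $a$ along its normal changes the color of the region from $r$ to $r*a$. A shadow coloring defines a map $\psi_X(D;\tilde{\mathcal C}):([0,1]^2,\partial[0,1]^2)\to(BX_Q^X,r)$, where $r$ is the color of the outer region: on the cell decomposition dual to $D$, a region of color $y$ gives the vertex $y$, an arc of color $a$ with source region $y$ gives the edge $(y;a)$, and a crossing gives the square $(y;a,b)$, where $y$ is its source region, $a$ the under arc adjoining it and $b$ the over arc. Omitting the colors of the regions, a coloring $\mathcal C$ defines in the same way a map $\xi_X(D;\mathcal C)$ to $B^QX$. Put $$\Psi_X(L)=\sum_{\tilde{\mathcal C}}[\psi_X(D;\tilde{\mathcal C})]\in\mathbb Z[\pi_2(BX_Q^X,r_0)],\qquad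 \Xi_X(L)=\sum_{\mathcal C}[\xi_X(D;\mathcal C)]\in\mathbb Z[\pi_2(B^QX)],$$ where the sums run over all shadow colorings and all colorings of $D$ by $X$, and the class of $\psi_X(D;\tilde{\mathcal C})$ is transported from the base point $r$ to $r_0$ along any path $\gamma_r$ from $r$ to $r_0$ in $BX_Q^X$. Then, for every $r_0$ and every choice of the paths $\gamma_r$, $$\tilde p_*\,\Psi_X(L)=|X|\;\Xi_X(L).$$ -/

import Mathlib

open scoped unitInterval Topology Quandles Topology.Homotopy

noncomputable section

namespace QuandleHomotopy

universe u v

/-! ## Quandles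

Mathlib writes quandles with a left action: `b ◃ a` is the element usually written `a * b` in the
right-handed convention, so that `(a * b) * c = (a * c) * (b * c)` is `Shelf.self_distrib`. -/

/-- The inner automorphism group of a quandle: the group of permutations of `X` generated by the
maps `x ↦ x * b = b ◃ x`. -/
def Inn (X : Type u) [Quandle X] : Subgroup (Equiv.Perm X) :=
  Subgroup.closure (Set.range fun b : X => Rack.act' b)

/-- A quandle is connected if its inner automorphism group acts transitively on it. -/
def IsConnectedQuandle (X : Type u) [Quandle X] : Prop :=
  MulAction.IsPretransitive (Inn X) X

/-- A set `Y` with a right action of the quandle `X`: each `a` acts by a bijection `y ↦ y * a`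
(here `act a y`), and `(y * a) * b = (y * b) * (a * b)`. -/
structure QuandleSet (X : Type u) [Quandle X] (Y : Type v) where
  act : X → Equiv.Perm Y
  act_act : ∀ a b y, act b (act a y) = act (b ◃ a) (act b y)

/-- The quandle acting on itself by `r * a = a ◃ r`. -/
def QuandleSet.regular (X : Type u) [Quandle X] : QuandleSet X X where
  act a := Rack.act' a
  act_act _ _ _ := Shelf.self_distrib

/-- The one-point set with the only possible action. -/
def QuandleSet.point (X : Type u) [Quandle X] : QuandleSet X PUnit.{1} where
  act _ := Equiv.refl _
  act_act _ _ _ := rfl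

/-! ## Rack spaces and quandle spaces -/

section Spaces

variable {X : Type u} [Quandle X] {Y : Type v}

/-- Labels `(y; x₁, …, x_n)` of the `n`-dimensional cubes. -/
structure CubeLabel (X : Type u) (Y : Type v) where
  dim : ℕ
  base : Y
  word : Fin dim → X

/-- Labels of the extra cells: a degenerate label `(y; x₁, …, x_{k+2})` together with a position
at which two consecutive letters agree. (`y` itself is not compared with `x₁`.) -/
structure PrismLabel (X : Type u) (Y : Type v) where
  k : ℕ
  base : Y
  word : Fin (k + 2) → X
  pos : Fin (k + 1)
  rep : word pos.castSucc = word pos.succ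

/-- The letters of the face `d_i^ε`: the letter `x_i` is deleted, and for `ε = 1` the letters
before it are multiplied by it. -/
def faceWord {n : ℕ} (i : Fin (n + 1)) (ε : Bool) (x : Fin (n + 1) → X) : Fin n → X := fun j =>
  if ε = true ∧ i.succAbove j < i then x i ◃ x (i.succAbove j) else x (i.succAbove j)

/-- The first entry of the face `d_i^ε`: it is multiplied by `x_i` for `ε = 1`. -/
def faceBase (A : QuandleSet X Y) {n : ℕ} (i : Fin (n + 1)) (ε : Bool) (y : Y)
    (x : Fin (n + 1) → X) : Y :=
  if ε = true then A.act (x i) y else y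

/-- The coface inclusion `I^n → I^{n+1}` that inserts `ε` as the `i`-th coordinate. -/
def coface {n : ℕ} (i : Fin (n + 1)) (ε : Bool) (t : Fin n → I) : Fin (n + 1) → I :=
  i.insertNth (if ε = true then (1 : I) else 0) t

/-- The disjoint union of all cells before gluing: a cube `I^n` for each label `(y; x₁, …, x_n)`,
and `I^{k+2} × I` for each degenerate label with a chosen repetition. The labels carry the
discrete topology. -/
abbrev Cells (X : Type u) (Y : Type v) : Type (max u v) :=
  (Σ c : CubeLabel X Y, Fin c.dim → I) ⊕ (Σ c : PrismLabel X Y, (Fin (c.k + 2) → I) × I)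

/-- The gluing relations.

* `face`: the cubes are glued along their faces as in the realization of a pre-cubic set.
* For a label with `x_i = x_{i+1}`, the faces `d_i^ε` and `d_{i+1}^ε` of the cube coincide, so that
  the `(t_i, t_{i+1})`-square becomes the 2-sphere `S = I² / (ε, u) ∼ (u, ε)`. The extra cell is
  `D³ × I^k`, where the ball `D³` is the cone on `S` in the square coordinates `(t_i, t_{i+1})` with
  radial coordinate `s`: `fold` turns the square into the sphere `S` at each level `s`, `apex`
  collapses the level `s = 1` to the centre of the ball, `bottom` attaches the boundary sphere
  `s = 0` to the cube with the same label, and `side` glues the faces of `D³ × I^k` in the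
  remaining `k` directions to the extra cells of one dimension less.
-/
inductive Glue (A : QuandleSet X Y) : Cells X Y → Cells X Y → Prop
  | face {n : ℕ} (y : Y) (x : Fin (n + 1) → X) (i : Fin (n + 1)) (ε : Bool) (t : Fin n → I) :
      Glue A (.inl ⟨⟨n + 1, y, x⟩, coface i ε t⟩)
        (.inl ⟨⟨n, faceBase A i ε y x, faceWord i ε x⟩, t⟩)
  | bottom (c : PrismLabel X Y) (t : Fin (c.k + 2) → I) :
      Glue A (.inr ⟨c, (t, 0)⟩) (.inl ⟨⟨c.k + 2, c.base, c.word⟩, t⟩)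
  | side {k : ℕ} (y : Y) (x : Fin (k + 3) → X) (p : Fin (k + 2)) (hp : x p.castSucc = x p.succ)
      (j : Fin (k + 3)) (ε : Bool) (q : Fin (k + 1))
      (hq : faceWord j ε x q.castSucc = faceWord j ε x q.succ)
      (h₀ : j.succAbove q.castSucc = p.castSucc) (h₁ : j.succAbove q.succ = p.succ)
      (t : Fin (k + 2) → I) (s : I) :
      Glue A (.inr ⟨⟨k + 1, y, x, p, hp⟩, (coface j ε t, s)⟩)
        (.inr ⟨⟨k, faceBase A j ε y x, faceWord j ε x, q, hq⟩, (t, s)⟩)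
  | fold (c : PrismLabel X Y) (t : Fin (c.k + 2) → I) (s : I)
      (ht : t c.pos.castSucc = 0 ∨ t c.pos.castSucc = 1) :
      Glue A (.inr ⟨c, (t, s)⟩) (.inr ⟨c, (t ∘ Equiv.swap c.pos.castSucc c.pos.succ, s)⟩)
  | apex (c : PrismLabel X Y) (t t' : Fin (c.k + 2) → I)
      (ht : ∀ l, l ≠ c.pos.castSucc → l ≠ c.pos.succ → t l = t' l) :
      Glue A (.inr ⟨c, (t, 1)⟩) (.inr ⟨c, (t', 1)⟩)

/-- The quandle space with coefficients in a `QuandleSet`: the realization of the pre-cubic set of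
all labels `(y; x₁, …, x_n)`, with the extra cells attached for the degenerate labels. -/
def QSpace (A : QuandleSet X Y) : Type (max u v) := Quot (Glue A)

instance (A : QuandleSet X Y) : TopologicalSpace (QSpace A) :=
  inferInstanceAs (TopologicalSpace (Quot (Glue A)))

/-- The projection of the cells onto the space. -/
def QSpace.mk (A : QuandleSet X Y) (c : Cells X Y) : QSpace A := Quot.mk _ c

/-- The vertex labelled by `y`. -/
def vtx (A : QuandleSet X Y) (y : Y) : QSpace A := QSpace.mk A (.inl ⟨⟨0, y, ![]⟩, ![]⟩)

/-- The edge labelled by `(y; a)`, from `y` to `y * a`. -/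
def edge (A : QuandleSet X Y) (y : Y) (a : X) (s : I) : QSpace A :=
  QSpace.mk A (.inl ⟨⟨1, y, ![a]⟩, ![s]⟩)

/-- The square labelled by `(y; a, b)`. -/
def square (A : QuandleSet X Y) (y : Y) (a b : X) (s t : I) : QSpace A :=
  QSpace.mk A (.inl ⟨⟨2, y, ![a, b]⟩, ![s, t]⟩)

end Spaces

/-- The action quandle space `BX_Q^X` of `X`. -/
abbrev ActionQuandleSpace (X : Type u) [Quandle X] : Type u := QSpace (QuandleSet.regular X)

/-- The quandle space `B^Q X` of `X`. -/
abbrev QuandleSpace (X : Type u) [Quandle X] : Type u := QSpace (QuandleSet.point X)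

/-- The base point of the quandle space, its only vertex. -/
abbrev basePoint (X : Type u) [Quandle X] : QuandleSpace X := vtx (QuandleSet.point X) PUnit.unit

/-- Forgetting the first entry of the labels of the cells. -/
def forgetCells (X : Type u) : Cells X X → Cells X PUnit.{1}
  | .inl ⟨c, t⟩ => .inl ⟨⟨c.dim, PUnit.unit, c.word⟩, t⟩
  | .inr ⟨c, t⟩ => .inr ⟨⟨c.k, PUnit.unit, c.word, c.pos, c.rep⟩, t⟩

theorem continuous_forgetCells (X : Type u) : Continuous (forgetCells X) := by
  refine continuous_sum_dom.2 ⟨continuous_sigma fun c => ?_, continuous_sigma fun c => ?_⟩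
  · exact continuous_inl.comp
      (continuous_sigmaMk (ι := CubeLabel X PUnit.{1}) (i := ⟨c.dim, PUnit.unit, c.word⟩))
  · exact continuous_inr.comp
      (continuous_sigmaMk (ι := PrismLabel X PUnit.{1})
        (i := ⟨c.k, PUnit.unit, c.word, c.pos, c.rep⟩))

/-- The projection `p̃ : BX_Q^X → B^Q X`, which maps the cell labelled by `(r; x₁, …, x_n)`
identically onto the cell labelled by `(x₁, …, x_n)`. -/
def proj (X : Type u) [Quandle X] : C(ActionQuandleSpace X, QuandleSpace X) where
  toFun := Quot.map (forgetCells X) (by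
    intro a b h
    cases h with
    | face y x i ε t => exact Glue.face (A := QuandleSet.point X) PUnit.unit x i ε t
    | bottom c t =>
      exact Glue.bottom (A := QuandleSet.point X) ⟨c.k, PUnit.unit, c.word, c.pos, c.rep⟩ t
    | side y x p hp j ε q hq h₀ h₁ t s =>
      exact Glue.side (A := QuandleSet.point X) PUnit.unit x p hp j ε q hq h₀ h₁ t s
    | fold c t s ht =>
      exact Glue.fold (A := QuandleSet.point X) ⟨c.k, PUnit.unit, c.word, c.pos, c.rep⟩ t s ht
    | apex c t t' ht =>
      exact Glue.apex (A := QuandleSet.point X) ⟨c.k, PUnit.unit, c.word, c.pos, c.rep⟩ t t' ht)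
  continuous_toFun := by
    refine continuous_quot_lift _ ?_
    exact continuous_quot_mk.comp (continuous_forgetCells X)

/-! ## Oriented link diagrams -/

/-- The four kinds of tiles. A tile carries up to two strands, joining its sides (south, north,
west, east) in pairs; a pair of sides may also be left empty. -/
inductive Tile
  /-- one arc joins south and west, one joins north and east -/
  | arcsSWNE
  /-- one arc joins south and east, one joins north and west -/
  | arcsSENW
  /-- a vertical strand over a horizontal strand -/
  | verticalOver
  /-- a horizontal strand over a vertical strand -/
  | horizontalOver

/-- Compatibility of a tile with the directions of the strands through its south, north, west and
east sides: `1` is upwards or rightwards, `-1` is downwards or leftwards, `0` means no strand. -/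
def Tile.FlowOK : Tile → (S N W E : SignType) → Prop
  | .arcsSWNE, S, N, W, E => W = -S ∧ E = -N
  | .arcsSENW, S, N, W, E => E = S ∧ N = W
  | .verticalOver, S, N, W, E => N = S ∧ E = W
  | .horizontalOver, S, N, W, E => N = S ∧ E = W

/-- A diagram of an oriented link in `I²`, drawn on a rectangular grid with `m + 1` columns and
`n + 1` rows of tiles: each side of a tile is crossed by at most one strand, strands avoid the grid
points, and nothing meets `∂I²`. Up to planar isotopy every oriented link diagram is of this
form. -/
structure OrientedLinkDiagram where
  m : ℕ
  n : ℕ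
  /-- the strand through the horizontal grid edge from `(i, j)` to `(i + 1, j)`: `1` if it runs
  upwards, `-1` if it runs downwards, `0` if there is none -/
  flowH : Fin (m + 1) → Fin (n + 2) → SignType
  /-- the strand through the vertical grid edge from `(i, j)` to `(i, j + 1)`: `1` if it runs to
  the right, `-1` if it runs to the left, `0` if there is none -/
  flowV : Fin (m + 2) → Fin (n + 1) → SignType
  tile : Fin (m + 1) → Fin (n + 1) → Tile
  tile_flow : ∀ i j, (tile i j).FlowOK (flowH i j.castSucc) (flowH i j.succ)
    (flowV i.castSucc j) (flowV i.succ j)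
  bottom_empty : ∀ i, flowH i 0 = 0
  top_empty : ∀ i, flowH i (Fin.last _) = 0
  left_empty : ∀ j, flowV 0 j = 0
  right_empty : ∀ j, flowV (Fin.last _) j = 0

/-! ## Colorings and shadow colorings -/

/-- What one meets when moving along a grid edge (to the right, or upwards): nothing, or a strand of
color `a`, crossed along its normal or against it. The normal of a strand points to its left. -/
inductive Passage (X : Type u)
  | none : Passage X
  | along (a : X) : Passage X
  | against (a : X) : Passage X

namespace Passage

variable {X : Type u} {Y : Type v}

/-- The direction of the normal of the strand, relative to the direction of motion. -/
def sign : Passage X → SignType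
  | none => 0
  | along _ => 1
  | against _ => -1

/-- The color of the strand, if there is one. -/
def color : Passage X → Option X
  | none => Option.none
  | along a => some a
  | against a => some a

/-- The passage met when moving in the opposite direction. -/
def rev : Passage X → Passage X
  | none => none
  | along a => against a
  | against a => along a

/-- The relation between the labels before and after the passage: crossing a strand of color `a`
along its normal changes the label from `y` to `y * a`. -/
def Acts [Quandle X] (A : QuandleSet X Y) : Passage X → Y → Y → Prop
  | none, y₀, y₁ => y₁ = y₀
  | along a, y₀, y₁ => y₁ = A.act a y₀
  | against a, y₀, y₁ => y₀ = A.act a y₁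

end Passage

/-- The rule at an over strand: when one moves across it along an under strand, the color of the
under strand changes from `a` to `a * b` in the direction of the normal of the over strand, where `b`
is the color of the over strand. (If there is no over strand, the color does not change.) -/
def UnderRule {X : Type u} [Quandle X] (upper under₀ under₁ : Passage X) : Prop :=
  ∀ a₀ ∈ under₀.color, ∀ a₁ ∈ under₁.color, upper.Acts (QuandleSet.regular X) a₀ a₁

/-- The coloring rules in a tile: arcs and over strands keep their color. -/
def Tile.ColorOK {X : Type u} [Quandle X] : Tile → (S N W E : Passage X) → Prop
  | .arcsSWNE, S, N, W, E => W = S ∧ E = N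
  | .arcsSENW, S, N, W, E => E = S.rev ∧ N = W.rev
  | .verticalOver, S, N, W, E => N = S ∧ E.sign = W.sign ∧ UnderRule S W E
  | .horizontalOver, S, N, W, E => E = W ∧ N.sign = S.sign ∧ UnderRule W S N

/-- A quandle coloring of a diagram: every strand through a grid edge gets a color, which is constant
along the arcs of the diagram, subject to the coloring relation at the crossings. -/
@[ext]
structure Coloring (D : OrientedLinkDiagram) (X : Type u) [Quandle X] where
  h : Fin (D.m + 1) → Fin (D.n + 2) → Passage X
  v : Fin (D.m + 2) → Fin (D.n + 1) → Passage X
  /-- the left normal of an upward strand points to the left -/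
  h_sign : ∀ i j, (h i j).sign = -D.flowH i j
  /-- the left normal of a rightward strand points upwards -/
  v_sign : ∀ i j, (v i j).sign = D.flowV i j
  tile_rule : ∀ i j, (D.tile i j).ColorOK (h i j.castSucc) (h i j.succ)
    (v i.castSucc j) (v i.succ j)

/-- A coloring of the regions of a diagram by `Y` that extends a given coloring of its arcs. Every
region contains grid points, and the label of a grid point is the color of its region: by the rules
for empty grid edges it depends on the region only. -/
@[ext]
structure RegionColoring {D : OrientedLinkDiagram} {X : Type u} [Quandle X] (C : Coloring D X)
    {Y : Type v} (A : QuandleSet X Y) where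
  label : Fin (D.m + 2) → Fin (D.n + 2) → Y
  h_rule : ∀ i j, (C.h i j).Acts A (label i.castSucc j) (label i.succ j)
  v_rule : ∀ i j, (C.v i j).Acts A (label i j.castSucc) (label i j.succ)

/-- A shadow coloring: a coloring of the arcs and the regions by `X`. -/
abbrev ShadowColoring (D : OrientedLinkDiagram) (X : Type u) [Quandle X] : Type u :=
  Σ C : Coloring D X, RegionColoring C (QuandleSet.regular X)

/-- The only coloring of the regions by one point. -/
def RegionColoring.trivial {D : OrientedLinkDiagram} {X : Type u} [Quandle X] (C : Coloring D X) :
    RegionColoring C (QuandleSet.point X) where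
  label _ _ := PUnit.unit
  h_rule i j := by cases C.h i j <;> exact Subsingleton.elim _ _
  v_rule i j := by cases C.v i j <;> exact Subsingleton.elim _ _

/-- The color of the region adjacent to the boundary of `I²`. -/
def RegionColoring.outer {D : OrientedLinkDiagram} {X : Type u} [Quandle X] {C : Coloring D X}
    {Y : Type v} {A : QuandleSet X Y} (R : RegionColoring C A) : Y := R.label 0 0

/-! ## The map of the square defined by a colored diagram -/

section TileMaps

variable {X : Type u} [Quandle X] {Y : Type v} (A : QuandleSet X Y)

/-- The map on a grid edge from a point labelled `y₀` to a point labelled `y₁`: it runs through the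
edge labelled by the source region and the color of the strand, in the direction of the normal. -/
def edgeMap : Passage X → (y₀ y₁ : Y) → I → QSpace A
  | .none, y₀, _, _ => vtx A y₀
  | .along a, y₀, _, t => edge A y₀ a t
  | .against a, _, y₁, t => edge A y₁ a (σ t)

/-- The map on a tile with an over strand and an under strand. The coordinate `t` crosses the over
strand and the coordinate `s` crosses the under strand; `under₀`, `under₁` are the passages across the
under strand on the sides `t = 0`, `t = 1`, and `y₀₀, y₀₁, y₁₀, y₁₁` are the labels of the corners
`(t, s) = (0,0), (0,1), (1,0), (1,1)`. A crossing is mapped onto the square labelled `(r; a, b)`,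
where `r` is the color of the source region, `a` the color of the under arc adjoining it and
`b` the color of the over arc. -/
def crossMap : (upper under₀ under₁ : Passage X) → (y₀₀ y₀₁ y₁₀ y₁₁ : Y) → (t s : I) → QSpace A
  | .none, under₀, _, y₀₀, y₀₁, _, _, _, s => edgeMap A under₀ y₀₀ y₀₁ s
  | .along b, .along a, _, y₀₀, _, _, _, t, s => square A y₀₀ a b s t
  | .along b, .against a, _, _, y₀₁, _, _, t, s => square A y₀₁ a b (σ s) t
  | .along b, .none, _, y₀₀, _, y₁₀, _, t, _ => edgeMap A (.along b) y₀₀ y₁₀ t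
  | .against b, _, .along a, _, _, y₁₀, _, t, s => square A y₁₀ a b s (σ t)
  | .against b, _, .against a, _, _, _, y₁₁, t, s => square A y₁₁ a b (σ s) (σ t)
  | .against b, _, .none, y₀₀, _, y₁₀, _, t, _ => edgeMap A (.against b) y₀₀ y₁₀ t

/-- Projection of a real number to the unit interval. -/
def toI (s : ℝ) : I := Set.projIcc 0 1 zero_le_one s

/-- The map on a tile, in its coordinates `(s, t)`; the labels of its corners are
`y₀₀, y₁₀, y₀₁, y₁₁` for `(s, t) = (0,0), (1,0), (0,1), (1,1)`. A pair of arcs is mapped through the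
corresponding edges. -/
def tileMap : Tile → (S N W E : Passage X) → (y₀₀ y₁₀ y₀₁ y₁₁ : Y) → (s t : I) → QSpace A
  | .arcsSWNE, S, _, _, E, y₀₀, y₁₀, _, y₁₁, s, t =>
    if (s : ℝ) + t ≤ 1 then edgeMap A S y₀₀ y₁₀ (toI (s + t))
    else edgeMap A E y₁₀ y₁₁ (toI (s + t - 1))
  | .arcsSENW, S, _, W, _, y₀₀, y₁₀, y₀₁, _, s, t =>
    if (t : ℝ) ≤ s then edgeMap A S y₀₀ y₁₀ (toI (s - t)) else edgeMap A W y₀₀ y₀₁ (toI (t - s))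
  | .verticalOver, S, _, W, E, y₀₀, y₁₀, y₀₁, y₁₁, s, t =>
    crossMap A S W E y₀₀ y₀₁ y₁₀ y₁₁ s t
  | .horizontalOver, S, N, W, _, y₀₀, y₁₀, y₀₁, y₁₁, s, t =>
    crossMap A W S N y₀₀ y₁₀ y₀₁ y₁₁ t s

end TileMaps

/-- The index of the interval of the subdivision of `I` into `m + 1` equal intervals that contains
`s`. -/
def gridIndex (m : ℕ) (s : I) : Fin (m + 1) :=
  ⟨min ⌊((m : ℝ) + 1) * s⌋₊ m, by omega⟩

/-- The coordinate of `s` relative to the `i`-th of the `m + 1` intervals. -/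
def gridCoord (m : ℕ) (i : Fin (m + 1)) (s : I) : I :=
  toI (((m : ℝ) + 1) * s - (i : ℕ))

/-- The map `I² → QSpace A` defined by a colored diagram, tile by tile. -/
def diagramFun {D : OrientedLinkDiagram} {X : Type u} [Quandle X] {C : Coloring D X}
    {Y : Type v} {A : QuandleSet X Y} (R : RegionColoring C A) (z : Fin 2 → I) : QSpace A :=
  let i := gridIndex D.m (z 0)
  let j := gridIndex D.n (z 1)
  tileMap A (D.tile i j) (C.h i j.castSucc) (C.h i j.succ) (C.v i.castSucc j) (C.v i.succ j)
    (R.label i.castSucc j.castSucc) (R.label i.succ j.castSucc)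
    (R.label i.castSucc j.succ) (R.label i.succ j.succ)
    (gridCoord D.m i (z 0)) (gridCoord D.n j (z 1))

/-! ### Well-definedness and continuity -/

section Continuity

variable {X : Type u} [Quandle X] {Y : Type v} (A : QuandleSet X Y)

theorem QSpace.continuous_mk : Continuous (QSpace.mk A) := continuous_quot_mk

theorem continuous_cube (c : CubeLabel X Y) :
    Continuous fun t : Fin c.dim → I => QSpace.mk A (.inl ⟨c, t⟩) :=
  (QSpace.continuous_mk A).comp (continuous_inl.comp continuous_sigmaMk)

theorem continuous_edge (y : Y) (a : X) : Continuous (edge A y a) :=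
  (continuous_cube A ⟨1, y, ![a]⟩).comp (by fun_prop)

theorem continuous_square (y : Y) (a b : X) :
    Continuous fun p : I × I => square A y a b p.1 p.2 :=
  (continuous_cube A ⟨2, y, ![a, b]⟩).comp (by
    refine continuous_pi fun k => ?_
    fin_cases k
    · exact continuous_fst
    · exact continuous_snd)

theorem glue_face {n : ℕ} (y : Y) (x : Fin (n + 1) → X) (i : Fin (n + 1)) (ε : Bool)
    (t : Fin n → I) {t' : Fin (n + 1) → I} {y' : Y} {x' : Fin n → X} (ht : t' = coface i ε t)
    (hy : faceBase A i ε y x = y') (hx : faceWord i ε x = x') :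
    QSpace.mk A (.inl ⟨⟨n + 1, y, x⟩, t'⟩) = QSpace.mk A (.inl ⟨⟨n, y', x'⟩, t⟩) := by
  subst ht hy hx
  exact Quot.sound (Glue.face y x i ε t)

theorem edge_zero (y : Y) (a : X) : edge A y a 0 = vtx A y :=
  glue_face A y ![a] 0 false ![] (by ext k; fin_cases k; rfl) rfl (Subsingleton.elim _ _)

theorem edge_one (y : Y) (a : X) : edge A y a 1 = vtx A (A.act a y) :=
  glue_face A y ![a] 0 true ![] (by ext k; fin_cases k; rfl) rfl (Subsingleton.elim _ _)

theorem square_zero_left (y : Y) (a b : X) (t : I) : square A y a b 0 t = edge A y b t :=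
  glue_face A y ![a, b] 0 false ![t] (by ext k; fin_cases k <;> rfl) rfl
    (by ext k; fin_cases k; rfl)

theorem square_one_left (y : Y) (a b : X) (t : I) :
    square A y a b 1 t = edge A (A.act a y) b t :=
  glue_face A y ![a, b] 0 true ![t] (by ext k; fin_cases k <;> rfl) rfl
    (by ext k; fin_cases k; rfl)

theorem square_zero_right (y : Y) (a b : X) (s : I) : square A y a b s 0 = edge A y a s :=
  glue_face A y ![a, b] 1 false ![s] (by ext k; fin_cases k <;> rfl) rfl
    (by ext k; fin_cases k; rfl)

theorem square_one_right (y : Y) (a b : X) (s : I) :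
    square A y a b s 1 = edge A (A.act b y) (b ◃ a) s :=
  glue_face A y ![a, b] 1 true ![s] (by ext k; fin_cases k <;> rfl) rfl
    (by ext k; fin_cases k; rfl)




theorem continuous_edgeMap (p : Passage X) (y₀ y₁ : Y) : Continuous (edgeMap A p y₀ y₁) := by
  cases p with
  | none => exact continuous_const
  | along a => exact continuous_edge A y₀ a
  | against a => exact (continuous_edge A y₁ a).comp unitInterval.continuous_symm

theorem edgeMap_zero (p : Passage X) (y₀ y₁ : Y) (h : p.Acts A y₀ y₁) :
    edgeMap A p y₀ y₁ 0 = vtx A y₀ := by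
  cases p with
  | none => rfl
  | along a => exact edge_zero A y₀ a
  | against a =>
    change y₀ = _ at h
    simp [edgeMap, edge_one, h]

theorem edgeMap_one (p : Passage X) (y₀ y₁ : Y) (h : p.Acts A y₀ y₁) :
    edgeMap A p y₀ y₁ 1 = vtx A y₁ := by
  cases p with
  | none =>
    change y₁ = y₀ at h
    rw [h]; rfl
  | along a =>
    change y₁ = _ at h
    rw [h]; exact edge_one A y₀ a
  | against a => simp [edgeMap, edge_zero]

theorem edgeMap_rev (p : Passage X) {y₀ y₁ y₂ : Y} (h : p.Acts A y₀ y₁) (h' : p.rev.Acts A y₁ y₂)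
    (t : I) : edgeMap A p.rev y₁ y₂ t = edgeMap A p y₀ y₁ (σ t) := by
  cases p with
  | none =>
    change y₁ = y₀ at h
    rw [h]; rfl
  | along a =>
    change y₁ = _ at h
    change y₁ = _ at h'
    have : y₂ = y₀ := (A.act a).injective (h'.symm.trans h)
    rw [this]; rfl
  | against a => simp [edgeMap, Passage.rev]

theorem crossMap_continuous (p q₀ q₁ : Passage X) (y₀₀ y₀₁ y₁₀ y₁₁ : Y) :
    Continuous fun z : I × I => crossMap A p q₀ q₁ y₀₀ y₀₁ y₁₀ y₁₁ z.1 z.2 := by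
  have hs : Continuous (σ : I → I) := unitInterval.continuous_symm
  cases p with
  | none => exact (continuous_edgeMap A q₀ y₀₀ y₀₁).comp continuous_snd
  | along b =>
    cases q₀ with
    | none => exact (continuous_edgeMap A (.along b) y₀₀ y₁₀).comp continuous_fst
    | along a => exact (continuous_square A y₀₀ a b).comp (continuous_snd.prodMk continuous_fst)
    | against a =>
      exact (continuous_square A y₀₁ a b).comp ((hs.comp continuous_snd).prodMk continuous_fst)
  | against b =>
    cases q₁ with
    | none => exact (continuous_edgeMap A (.against b) y₀₀ y₁₀).comp continuous_fst
    | along a =>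
      exact (continuous_square A y₁₀ a b).comp (continuous_snd.prodMk (hs.comp continuous_fst))
    | against a =>
      exact (continuous_square A y₁₁ a b).comp
        ((hs.comp continuous_snd).prodMk (hs.comp continuous_fst))

section Cross

variable {p q₀ q₁ : Passage X} {y₀₀ y₀₁ y₁₀ y₁₁ : Y}

theorem crossMap_t_zero (hq : q₁.sign = q₀.sign)
    (hu : UnderRule p q₀ q₁) (h0 : q₀.Acts A y₀₀ y₀₁) (h1 : q₁.Acts A y₁₀ y₁₁)
    (k0 : p.Acts A y₀₀ y₁₀) (k1 : p.Acts A y₀₁ y₁₁) (s : I) :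
    crossMap A p q₀ q₁ y₀₀ y₀₁ y₁₀ y₁₁ 0 s = edgeMap A q₀ y₀₀ y₀₁ s := by
  cases p <;> cases q₀ <;> cases q₁ <;>
    simp_all [crossMap, edgeMap, Passage.sign, Passage.Acts, UnderRule, Passage.color,
      square_zero_right, square_one_right, edge_zero, edge_one, QuandleSet.regular]

theorem crossMap_t_one (hq : q₁.sign = q₀.sign)
    (hu : UnderRule p q₀ q₁) (h0 : q₀.Acts A y₀₀ y₀₁) (h1 : q₁.Acts A y₁₀ y₁₁)
    (k0 : p.Acts A y₀₀ y₁₀) (k1 : p.Acts A y₀₁ y₁₁) (s : I) :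
    crossMap A p q₀ q₁ y₀₀ y₀₁ y₁₀ y₁₁ 1 s = edgeMap A q₁ y₁₀ y₁₁ s := by
  cases p <;> cases q₀ <;> cases q₁ <;>
    simp_all [crossMap, edgeMap, Passage.sign, Passage.Acts, UnderRule, Passage.color,
      square_zero_right, square_one_right, edge_zero, edge_one, QuandleSet.regular]

theorem crossMap_s_zero (hq : q₁.sign = q₀.sign)
    (hu : UnderRule p q₀ q₁) (h0 : q₀.Acts A y₀₀ y₀₁) (h1 : q₁.Acts A y₁₀ y₁₁)
    (k0 : p.Acts A y₀₀ y₁₀) (k1 : p.Acts A y₀₁ y₁₁) (t : I) :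
    crossMap A p q₀ q₁ y₀₀ y₀₁ y₁₀ y₁₁ t 0 = edgeMap A p y₀₀ y₁₀ t := by
  cases p <;> cases q₀ <;> cases q₁ <;>
    simp_all [crossMap, edgeMap, Passage.sign, Passage.Acts, UnderRule, Passage.color,
      square_zero_left, square_one_left, edge_zero, edge_one, QuandleSet.regular]

theorem crossMap_s_one (hq : q₁.sign = q₀.sign)
    (hu : UnderRule p q₀ q₁) (h0 : q₀.Acts A y₀₀ y₀₁) (h1 : q₁.Acts A y₁₀ y₁₁)
    (k0 : p.Acts A y₀₀ y₁₀) (k1 : p.Acts A y₀₁ y₁₁) (t : I) :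
    crossMap A p q₀ q₁ y₀₀ y₀₁ y₁₀ y₁₁ t 1 = edgeMap A p y₀₁ y₁₁ t := by
  cases p <;> cases q₀ <;> cases q₁ <;>
    simp_all [crossMap, edgeMap, Passage.sign, Passage.Acts, UnderRule, Passage.color,
      square_zero_left, square_one_left, edge_zero, edge_one, QuandleSet.regular]

end Cross

theorem toI_coe (s : I) : toI s = s := Set.projIcc_val zero_le_one s

theorem toI_of_eq {x : ℝ} (s : I) (h : x = s) : toI x = s := by rw [h, toI_coe]

theorem continuous_toI : Continuous toI :=
  continuous_projIcc (h := zero_le_one)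

section TileSides

variable {T : Tile} {S N W E : Passage X} {y₀₀ y₁₀ y₀₁ y₁₁ : Y}

theorem tileMap_continuous (hS : S.Acts A y₀₀ y₁₀)
    (hW : W.Acts A y₀₀ y₀₁) (hE : E.Acts A y₁₀ y₁₁) :
    Continuous fun z : I × I => tileMap A T S N W E y₀₀ y₁₀ y₀₁ y₁₁ z.1 z.2 := by
  cases T with
  | arcsSWNE =>
    refine Continuous.if_le ?_ ?_ (by fun_prop) (by fun_prop) ?_
    · exact (continuous_edgeMap A _ _ _).comp (continuous_toI.comp (by fun_prop))
    · exact (continuous_edgeMap A _ _ _).comp (continuous_toI.comp (by fun_prop))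
    · intro z hz
      rw [toI_of_eq 1 (by simpa using hz), toI_of_eq 0 (by simp [hz]), edgeMap_one A _ _ _ hS,
        edgeMap_zero A _ _ _ hE]
  | arcsSENW =>
    refine Continuous.if_le ?_ ?_ (by fun_prop) (by fun_prop) ?_
    · exact (continuous_edgeMap A _ _ _).comp (continuous_toI.comp (by fun_prop))
    · exact (continuous_edgeMap A _ _ _).comp (continuous_toI.comp (by fun_prop))
    · intro z hz
      rw [toI_of_eq 0 (by simp [hz]), toI_of_eq 0 (by simp [hz]), edgeMap_zero A _ _ _ hS,
        edgeMap_zero A _ _ _ hW]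
  | verticalOver => exact crossMap_continuous A _ _ _ _ _ _ _
  | horizontalOver => exact (crossMap_continuous A _ _ _ _ _ _ _).comp continuous_swap

theorem tileMap_south (hc : T.ColorOK S N W E) (hS : S.Acts A y₀₀ y₁₀)
    (hN : N.Acts A y₀₁ y₁₁) (hW : W.Acts A y₀₀ y₀₁) (hE : E.Acts A y₁₀ y₁₁) (s : I) :
    tileMap A T S N W E y₀₀ y₁₀ y₀₁ y₁₁ s 0 = edgeMap A S y₀₀ y₁₀ s := by
  cases T with
  | arcsSWNE =>
    have : (s : ℝ) + (0 : I) ≤ 1 := by simpa using s.2.2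
    simp only [tileMap, if_pos this]
    rw [toI_of_eq s (by simp)]
  | arcsSENW =>
    have : ((0 : I) : ℝ) ≤ s := s.2.1
    simp only [tileMap, if_pos this]
    rw [toI_of_eq s (by simp)]
  | verticalOver =>
    obtain ⟨rfl, h2, h3⟩ := hc
    exact crossMap_s_zero A h2 h3 hW hE hS hN s
  | horizontalOver =>
    obtain ⟨rfl, h2, h3⟩ := hc
    exact crossMap_t_zero A h2 h3 hS hN hW hE s

theorem tileMap_north (hc : T.ColorOK S N W E) (hS : S.Acts A y₀₀ y₁₀)
    (hN : N.Acts A y₀₁ y₁₁) (hW : W.Acts A y₀₀ y₀₁) (hE : E.Acts A y₁₀ y₁₁) (s : I) :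
    tileMap A T S N W E y₀₀ y₁₀ y₀₁ y₁₁ s 1 = edgeMap A N y₀₁ y₁₁ s := by
  cases T with
  | arcsSWNE =>
    obtain ⟨rfl, rfl⟩ := hc
    have e : y₁₀ = y₀₁ := by
      cases W <;> simp_all [Passage.Acts]
    subst e
    by_cases h : (s : ℝ) + (1 : I) ≤ 1
    · have hs : s = 0 := Subtype.ext (le_antisymm (by simpa using h) s.2.1)
      subst hs
      simp only [tileMap, if_pos h]
      rw [toI_of_eq 1 (by simp), edgeMap_one A _ _ _ hS, edgeMap_zero A _ _ _ hE]
    · simp only [tileMap, if_neg h]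
      rw [toI_of_eq s (by simp)]
  | arcsSENW =>
    obtain ⟨rfl, rfl⟩ := hc
    rw [edgeMap_rev A W hW hN]
    by_cases h : ((1 : I) : ℝ) ≤ s
    · have hs : s = 1 := Subtype.ext (le_antisymm s.2.2 h)
      subst hs
      simp only [tileMap, if_pos h]
      rw [toI_of_eq 0 (by simp), edgeMap_zero A _ _ _ hS, unitInterval.symm_one,
        edgeMap_zero A _ _ _ hW]
    · simp only [tileMap, if_neg h]
      rw [toI_of_eq (σ s) (by simp)]
  | verticalOver =>
    obtain ⟨rfl, h2, h3⟩ := hc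
    exact crossMap_s_one A h2 h3 hW hE hS hN s
  | horizontalOver =>
    obtain ⟨rfl, h2, h3⟩ := hc
    exact crossMap_t_one A h2 h3 hS hN hW hE s

theorem tileMap_west (hc : T.ColorOK S N W E) (hS : S.Acts A y₀₀ y₁₀)
    (hN : N.Acts A y₀₁ y₁₁) (hW : W.Acts A y₀₀ y₀₁) (hE : E.Acts A y₁₀ y₁₁) (t : I) :
    tileMap A T S N W E y₀₀ y₁₀ y₀₁ y₁₁ 0 t = edgeMap A W y₀₀ y₀₁ t := by
  cases T with
  | arcsSWNE =>
    obtain ⟨rfl, rfl⟩ := hc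
    have e : y₁₀ = y₀₁ := by
      cases W <;> simp_all [Passage.Acts]
    subst e
    have : ((0 : I) : ℝ) + t ≤ 1 := by simpa using t.2.2
    simp only [tileMap, if_pos this]
    rw [toI_of_eq t (by simp)]
  | arcsSENW =>
    by_cases h : (t : ℝ) ≤ (0 : I)
    · have ht : t = 0 := Subtype.ext (le_antisymm h t.2.1)
      subst ht
      simp only [tileMap, if_pos h]
      rw [toI_of_eq 0 (by simp), edgeMap_zero A _ _ _ hS, edgeMap_zero A _ _ _ hW]
    · simp only [tileMap, if_neg h]
      rw [toI_of_eq t (by simp)]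
  | verticalOver =>
    obtain ⟨rfl, h2, h3⟩ := hc
    exact crossMap_t_zero A h2 h3 hW hE hS hN t
  | horizontalOver =>
    obtain ⟨rfl, h2, h3⟩ := hc
    exact crossMap_s_zero A h2 h3 hS hN hW hE t

theorem tileMap_east (hc : T.ColorOK S N W E) (hS : S.Acts A y₀₀ y₁₀)
    (hN : N.Acts A y₀₁ y₁₁) (hW : W.Acts A y₀₀ y₀₁) (hE : E.Acts A y₁₀ y₁₁) (t : I) :
    tileMap A T S N W E y₀₀ y₁₀ y₀₁ y₁₁ 1 t = edgeMap A E y₁₀ y₁₁ t := by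
  cases T with
  | arcsSWNE =>
    by_cases h : ((1 : I) : ℝ) + t ≤ 1
    · have ht : t = 0 := Subtype.ext (le_antisymm (by simpa using h) t.2.1)
      subst ht
      simp only [tileMap, if_pos h]
      rw [toI_of_eq 1 (by simp), edgeMap_one A _ _ _ hS, edgeMap_zero A _ _ _ hE]
    · simp only [tileMap, if_neg h]
      rw [toI_of_eq t (by simp)]
  | arcsSENW =>
    obtain ⟨rfl, rfl⟩ := hc
    have : (t : ℝ) ≤ (1 : I) := t.2.2
    rw [edgeMap_rev A S hS hE]
    simp only [tileMap, if_pos this]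
    rw [toI_of_eq (σ t) (by simp)]
  | verticalOver =>
    obtain ⟨rfl, h2, h3⟩ := hc
    exact crossMap_t_one A h2 h3 hW hE hS hN t
  | horizontalOver =>
    obtain ⟨rfl, h2, h3⟩ := hc
    exact crossMap_s_one A h2 h3 hS hN hW hE t

end TileSides

theorem continuous_gridCoord (m : ℕ) (i : Fin (m + 1)) : Continuous (gridCoord m i) :=
  continuous_toI.comp (by fun_prop)

/-- The `i`-th of the `m + 1` intervals. -/
def gridInterval (m : ℕ) (i : Fin (m + 1)) : Set I :=
  {s | ((i : ℕ) : ℝ) ≤ ((m : ℝ) + 1) * s ∧ ((m : ℝ) + 1) * s ≤ ((i : ℕ) : ℝ) + 1}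

theorem isClosed_gridInterval (m : ℕ) (i : Fin (m + 1)) : IsClosed (gridInterval m i) := by
  have h : Continuous fun s : I => ((m : ℝ) + 1) * s := by fun_prop
  exact (isClosed_le continuous_const h).inter (isClosed_le h continuous_const)

theorem mem_gridInterval (m : ℕ) (s : I) : s ∈ gridInterval m (gridIndex m s) := by
  have h0 : 0 ≤ ((m : ℝ) + 1) * s := mul_nonneg (by positivity) s.2.1
  have h1 : ((m : ℝ) + 1) * s ≤ m + 1 := mul_le_of_le_one_right (by positivity) s.2.2
  refine ⟨?_, ?_⟩
  · refine le_trans ?_ (Nat.floor_le h0)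
    simp [gridIndex]
  · have h2 := (Nat.lt_floor_add_one (((m : ℝ) + 1) * s)).le
    rcases le_total ⌊((m : ℝ) + 1) * s⌋₊ m with h | h
    · simpa [gridIndex, min_eq_left h] using h2
    · simpa [gridIndex, min_eq_right h] using h1

/-- Functions on the intervals that agree at the common end points give the same value at `s` for
every interval that contains `s`. -/
theorem grid_glue {Z : Type*} {m : ℕ} (g : Fin (m + 1) → I → Z)
    (hg : ∀ i i' : Fin (m + 1), (i' : ℕ) = i + 1 → g i 1 = g i' 0) {s : I} {i : Fin (m + 1)}
    (hs : s ∈ gridInterval m i) :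
    g (gridIndex m s) (gridCoord m (gridIndex m s) s) = g i (gridCoord m i s) := by
  have hm := mem_gridInterval m s
  have key : (gridIndex m s : ℕ) = i ∨ (gridIndex m s : ℕ) = i + 1 := by
    have h0 : 0 ≤ ((m : ℝ) + 1) * s := mul_nonneg (by positivity) s.2.1
    have a1 : (i : ℕ) ≤ ⌊((m : ℝ) + 1) * s⌋₊ := Nat.le_floor hs.1
    have a2 : ⌊((m : ℝ) + 1) * s⌋₊ ≤ i + 1 := by
      refine Nat.floor_le_of_le ?_
      exact_mod_cast hs.2
    have a3 := i.2
    simp only [gridIndex]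
    omega
  rcases key with h | h
  · rw [Fin.ext h]
  · have e : ((m : ℝ) + 1) * s = (i : ℕ) + 1 := by
      refine le_antisymm hs.2 ?_
      have := hm.1
      rw [h] at this
      exact_mod_cast this
    have e1 : gridCoord m i s = 1 := toI_of_eq 1 (by rw [e]; simp)
    have e2 : gridCoord m (gridIndex m s) s = 0 := toI_of_eq 0 (by rw [e, h]; simp)
    rw [e1, e2]
    exact (hg _ _ h).symm

variable {A} {D : OrientedLinkDiagram} {C : Coloring D X} (R : RegionColoring C A)

/-- The map on the tile `(i, j)`. -/
def tileFun (i : Fin (D.m + 1)) (j : Fin (D.n + 1)) (s t : I) : QSpace A :=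
  tileMap A (D.tile i j) (C.h i j.castSucc) (C.h i j.succ) (C.v i.castSucc j) (C.v i.succ j)
    (R.label i.castSucc j.castSucc) (R.label i.succ j.castSucc)
    (R.label i.castSucc j.succ) (R.label i.succ j.succ) s t

theorem diagramFun_eq {i : Fin (D.m + 1)} {j : Fin (D.n + 1)} {z : Fin 2 → I}
    (hi : z 0 ∈ gridInterval D.m i) (hj : z 1 ∈ gridInterval D.n j) :
    diagramFun R z = tileFun R i j (gridCoord D.m i (z 0)) (gridCoord D.n j (z 1)) := by
  change tileFun R (gridIndex D.m (z 0)) (gridIndex D.n (z 1)) _ _ = _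
  rw [grid_glue (fun i s => tileFun R i (gridIndex D.n (z 1)) s
    (gridCoord D.n (gridIndex D.n (z 1)) (z 1))) ?_ hi]
  · refine grid_glue (fun j t => tileFun R i j (gridCoord D.m i (z 0)) t) ?_ hj
    intro j j' h
    have e : j.succ = j'.castSucc := Fin.ext (by simp [h])
    refine (tileMap_north A (C.tile_rule i j) (R.h_rule _ _) (R.h_rule _ _) (R.v_rule _ _)
      (R.v_rule _ _) _).trans ?_
    rw [e]
    exact (tileMap_south A (C.tile_rule i j') (R.h_rule _ _) (R.h_rule _ _) (R.v_rule _ _)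
      (R.v_rule _ _) _).symm
  · intro i i' h
    have e : i.succ = i'.castSucc := Fin.ext (by simp [h])
    refine (tileMap_east A (C.tile_rule i _) (R.h_rule _ _) (R.h_rule _ _) (R.v_rule _ _)
      (R.v_rule _ _) _).trans ?_
    rw [e]
    exact (tileMap_west A (C.tile_rule i' _) (R.h_rule _ _) (R.h_rule _ _) (R.v_rule _ _)
      (R.v_rule _ _) _).symm

theorem continuous_diagramFun : Continuous (diagramFun R) := by
  refine (locallyFinite_of_finite fun k : Fin (D.m + 1) × Fin (D.n + 1) =>
    {z : Fin 2 → I | z 0 ∈ gridInterval D.m k.1 ∧ z 1 ∈ gridInterval D.n k.2}).continuous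
    ?_ ?_ ?_
  · refine Set.eq_univ_of_forall fun z => Set.mem_iUnion.2
      ⟨(gridIndex D.m (z 0), gridIndex D.n (z 1)), mem_gridInterval _ _, mem_gridInterval _ _⟩
  · rintro ⟨i, j⟩
    have h0 : Continuous fun z : Fin 2 → I => z 0 := continuous_apply 0
    have h1 : Continuous fun z : Fin 2 → I => z 1 := continuous_apply 1
    exact ((isClosed_gridInterval D.m i).preimage h0).inter
      ((isClosed_gridInterval D.n j).preimage h1)
  · rintro ⟨i, j⟩
    have hc : Continuous fun z : Fin 2 → I =>
        tileFun R i j (gridCoord D.m i (z 0)) (gridCoord D.n j (z 1)) :=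
      (tileMap_continuous A (R.h_rule _ _) (R.v_rule _ _) (R.v_rule _ _)).comp (((continuous_gridCoord D.m i).comp (continuous_apply 0)).prodMk
          ((continuous_gridCoord D.n j).comp (continuous_apply 1)))
    exact hc.continuousOn.congr fun z hz => diagramFun_eq R hz.1 hz.2

/-- All grid points on `∂I²` have the color of the outer region. -/
theorem label_boundary (i : Fin (D.m + 2)) (j : Fin (D.n + 2))
    (h : i = 0 ∨ i = Fin.last _ ∨ j = 0 ∨ j = Fin.last _) : R.label i j = R.outer := by
  have emptyH : ∀ i j, D.flowH i j = 0 → R.label i.succ j = R.label i.castSucc j := by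
    intro i j h
    have h1 := C.h_sign i j
    have h2 := R.h_rule i j
    cases hp : C.h i j <;> simp_all [Passage.sign, Passage.Acts]
  have emptyV : ∀ i j, D.flowV i j = 0 → R.label i j.succ = R.label i j.castSucc := by
    intro i j h
    have h1 := C.v_sign i j
    have h2 := R.v_rule i j
    cases hp : C.v i j <;> simp_all [Passage.sign, Passage.Acts]
  have b : ∀ i, R.label i 0 = R.outer := fun i => by
    induction i using Fin.induction with
    | zero => rfl
    | succ i ih => rw [emptyH i 0 (D.bottom_empty i), ih]
  have l : ∀ j, R.label 0 j = R.outer := fun j => by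
    induction j using Fin.induction with
    | zero => rfl
    | succ j ih => rw [emptyV 0 j (D.left_empty j), ih]
  rcases h with rfl | rfl | rfl | rfl
  · exact l j
  · induction j using Fin.induction with
    | zero => exact b _
    | succ j ih => rw [emptyV _ j (D.right_empty j), ih]
  · exact b i
  · induction i using Fin.induction with
    | zero => exact l _
    | succ i ih => rw [emptyH i _ (D.top_empty i), ih]

theorem edgeMap_empty {p : Passage X} (h : p.sign = 0) (y₀ y₁ : Y) (t : I) :
    edgeMap A p y₀ y₁ t = vtx A y₀ := by
  cases p with
  | none => rfl
  | along a => simp [Passage.sign] at h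
  | against a => simp [Passage.sign] at h

theorem diagramFun_boundary (z : Fin 2 → I) (hz : z ∈ Cube.boundary (Fin 2)) :
    diagramFun R z = vtx A R.outer := by
  have hi := mem_gridInterval D.m (z 0)
  have hj := mem_gridInterval D.n (z 1)
  have zero_mem : ∀ m, (0 : I) ∈ gridInterval m 0 := fun m => by
    constructor <;> simp
  have one_mem : ∀ m, (1 : I) ∈ gridInterval m (Fin.last m) := fun m => by
    constructor <;> simp
  have c0 : ∀ m, gridCoord m 0 0 = 0 := fun m => toI_of_eq 0 (by simp)
  have c1 : ∀ m, gridCoord m (Fin.last m) 1 = 1 := fun m => toI_of_eq 1 (by simp)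
  obtain ⟨k, hk⟩ := hz
  fin_cases k
  · rcases hk with hk | hk <;> simp only [Fin.zero_eta] at hk
    · rw [hk] at hi
      rw [diagramFun_eq R (i := 0) (by rw [hk]; exact zero_mem _) hj, hk, c0]
      refine (tileMap_west A (C.tile_rule 0 _) (R.h_rule _ _) (R.h_rule _ _) (R.v_rule _ _)
        (R.v_rule _ _) _).trans ?_
      rw [edgeMap_empty]
      · exact congrArg (vtx A) (label_boundary R _ _ (.inl rfl))
      rw [C.v_sign]
      exact D.left_empty _
    · rw [diagramFun_eq R (i := Fin.last _) (by rw [hk]; exact one_mem _) hj, hk, c1]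
      refine (tileMap_east A (C.tile_rule (Fin.last _) _) (R.h_rule _ _) (R.h_rule _ _)
        (R.v_rule _ _) (R.v_rule _ _) _).trans ?_
      rw [edgeMap_empty]
      · exact congrArg (vtx A) (label_boundary R _ _ (.inr (.inl rfl)))
      rw [C.v_sign]
      exact D.right_empty _
  · rcases hk with hk | hk <;> simp only [Fin.mk_one] at hk
    · rw [diagramFun_eq R (j := 0) hi (by rw [hk]; exact zero_mem _), hk, c0]
      refine (tileMap_south A (C.tile_rule _ 0) (R.h_rule _ _) (R.h_rule _ _) (R.v_rule _ _)
        (R.v_rule _ _) _).trans ?_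
      rw [edgeMap_empty]
      · exact congrArg (vtx A) (label_boundary R _ _ (.inr (.inr (.inl rfl))))
      rw [C.h_sign, Fin.castSucc_zero, D.bottom_empty]
      rfl
    · rw [diagramFun_eq R (j := Fin.last _) hi (by rw [hk]; exact one_mem _), hk, c1]
      refine (tileMap_north A (C.tile_rule _ (Fin.last _)) (R.h_rule _ _) (R.h_rule _ _)
        (R.v_rule _ _) (R.v_rule _ _) _).trans ?_
      rw [edgeMap_empty]
      · exact congrArg (vtx A) (label_boundary R _ _ (.inr (.inr (.inr rfl))))
      rw [C.h_sign, Fin.succ_last, D.top_empty]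
      rfl

end Continuity

/-- The map of pairs `(I², ∂I²) → (QSpace A, y)` defined by a colored diagram, where `y` is the color
of the outer region. -/
def diagramLoop {D : OrientedLinkDiagram} {X : Type u} [Quandle X] {C : Coloring D X}
    {Y : Type v} {A : QuandleSet X Y} (R : RegionColoring C A) :
    Ω^ (Fin 2) (QSpace A) (vtx A R.outer) :=
  ⟨⟨diagramFun R, continuous_diagramFun R⟩, diagramFun_boundary R⟩

/-! ## Finiteness of the sets of colorings -/

instance {X : Type u} [Finite X] : Finite (Passage X) :=
  Finite.of_injective
    (fun p : Passage X => (p.color, (p.sign : SignType))) (by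
      intro p q h
      cases p <;> cases q <;> simp_all [Passage.color, Passage.sign])

instance (D : OrientedLinkDiagram) (X : Type u) [Quandle X] [Finite X] : Finite (Coloring D X) :=
  Finite.of_injective (fun C => (C.h, C.v)) (by
    intro C C' h
    exact Coloring.ext (congrArg Prod.fst h) (congrArg Prod.snd h))

instance {D : OrientedLinkDiagram} {X : Type u} [Quandle X] (C : Coloring D X)
    {Y : Type v} [Finite Y] (A : QuandleSet X Y) : Finite (RegionColoring C A) :=
  Finite.of_injective (fun R => R.label) fun _ _ h => RegionColoring.ext h

instance (D : OrientedLinkDiagram) (X : Type u) [Quandle X] [Finite X] : Fintype (Coloring D X) :=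
  Fintype.ofFinite _

instance (D : OrientedLinkDiagram) (X : Type u) [Quandle X] [Finite X] :
    Fintype (ShadowColoring D X) :=
  Fintype.ofFinite _

/-! ## Change of base point -/

section BaseChange

variable {Z : Type*} [TopologicalSpace Z] {x y : Z}

/-- The distance of a point of `I²` from the centre in the maximum norm, scaled to be `1` on
`∂I²`. -/
def depth (z : Fin 2 → I) : ℝ := max |2 * (z 0 : ℝ) - 1| |2 * (z 1 : ℝ) - 1|

theorem continuous_depth : Continuous depth := by
  unfold depth
  fun_prop

/-- The change of base point along a path `γ` from `x` to `y`: the map `f : (I², ∂I²) → (Z, x)` on the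
concentric square of half the size, and the path `γ` on every radial segment from the boundary of this
square to `∂I²`. -/
def baseChange (γ : Path x y) (f : Ω^ (Fin 2) Z x) : Ω^ (Fin 2) Z y where
  val :=
    { toFun := fun z => if depth z ≤ 1 / 2 then f fun k => toI (2 * (z k : ℝ) - 1 / 2)
        else γ (toI (2 * depth z - 1))
      continuous_toFun := by
        refine Continuous.if_le ?_ ?_ continuous_depth continuous_const ?_
        · exact f.1.continuous.comp (continuous_pi fun k => continuous_toI.comp (by fun_prop))
        · exact γ.continuous.comp (continuous_toI.comp
            ((continuous_const.mul continuous_depth).sub continuous_const))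
        · intro z hz
          rw [toI_of_eq 0 (by rw [hz]; norm_num), γ.source]
          refine f.2 _ ?_
          have key : ∀ k, |2 * (z k : ℝ) - 1| = 1 / 2 →
              (fun k => toI (2 * (z k : ℝ) - 1 / 2)) ∈ Cube.boundary (Fin 2) := by
            intro k hk
            refine ⟨k, ?_⟩
            rcases eq_or_eq_neg_of_abs_eq hk with h | h
            · exact .inr (toI_of_eq 1 (by simp; linarith))
            · exact .inl (toI_of_eq 0 (by simp; linarith))
          rcases max_choice |2 * (z 0 : ℝ) - 1| |2 * (z 1 : ℝ) - 1| with h | h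
          · exact key 0 (h ▸ hz)
          · exact key 1 (h ▸ hz) }
  property := by
    intro z hz
    have hle : ∀ k, |2 * (z k : ℝ) - 1| ≤ 1 := fun k => by
      have h0 := (z k).2.1
      have h1 := (z k).2.2
      rw [abs_le]
      constructor <;> linarith
    have h1 : depth z = 1 := by
      refine le_antisymm (max_le (hle 0) (hle 1)) ?_
      obtain ⟨k, hk⟩ := hz
      have hk' : |2 * (z k : ℝ) - 1| = 1 := by
        rcases hk with hk | hk <;> rw [hk] <;> norm_num
      fin_cases k
      · exact hk'.symm.le.trans (le_max_left _ _)
      · exact hk'.symm.le.trans (le_max_right _ _)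
    change (if depth z ≤ 1 / 2 then _ else γ (toI (2 * depth z - 1))) = y
    rw [if_neg (by rw [h1]; norm_num), toI_of_eq 1 (by rw [h1]; norm_num), γ.target]

/-- Composition of a map `(I², ∂I²) → (Z, x)` with a continuous map. -/
def mapLoop {Z' : Type*} [TopologicalSpace Z'] (g : C(Z, Z')) (f : Ω^ (Fin 2) Z x) :
    Ω^ (Fin 2) Z' (g x) :=
  ⟨g.comp f.1, fun z hz => congrArg g (f.2 z hz)⟩

end BaseChange

/-! ## The invariants -/

/-- The quandle homotopy invariant `Ξ_X(L) = ∑ [ξ_X(D; C)]`, the sum over the colorings of a diagram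
`D` of `L`, in the group ring `ℤ[π₂(B^Q X)]`. -/
def quandleHomotopyInvariant (X : Type u) [Quandle X] [Finite X] (D : OrientedLinkDiagram) :
    MonoidAlgebra ℤ (π_ 2 (QuandleSpace X) (basePoint X)) :=
  ∑ C : Coloring D X, MonoidAlgebra.single ⟦diagramLoop (RegionColoring.trivial C)⟧ 1

/-- The shadow homotopy invariant `Ψ_X(L) = ∑ [ψ_X(D; C̃)]`, the sum over the shadow colorings of a
diagram `D` of `L`, in the group ring `ℤ[π₂(BX_Q^X, r₀)]`. The class of the map `ψ_X(D; C̃)`, whose base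
point is the color `r` of the outer region, is transported to the base point `r₀` along the path `γ r`. -/
def shadowHomotopyInvariant (X : Type u) [Quandle X] [Finite X] (D : OrientedLinkDiagram) (r₀ : X)
    (γ : ∀ r : X, Path (vtx (QuandleSet.regular X) r) (vtx (QuandleSet.regular X) r₀)) :
    MonoidAlgebra ℤ (π_ 2 (ActionQuandleSpace X) (vtx (QuandleSet.regular X) r₀)) :=
  ∑ C : ShadowColoring D X,
    MonoidAlgebra.single ⟦baseChange (γ C.2.outer) (diagramLoop C.2)⟧ 1

end QuandleHomotopy

end

/-! # The shadow homotopy invariant and the quandle homotopy invariant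

The projection from the quandle space with coefficients in `Y` to the quandle space is a covering
map for every `Y` (`isCoveringMap_projPoint`). A threshold `τ ∈ (0, 1)` assigns every point of a cube
whose coordinates differ from `τ` to a vertex, and the label of this vertex, a product of actions of
letters, is locally constant and compatible with the gluing. It trivializes the projection over an
open set, and `τ` can be chosen such that a given point of a cube lies in this set. In the interior
of an attached ball, the same works with the coordinates transverse to the ball. A covering map
induces an isomorphism of second homotopy groups (`piTwoEquiv`), by lifting maps and homotopies.

A coloring extends to exactly one shadow coloring for each color of the outer region
(`RegionColoring.outerEquiv`), and its class projects to the class of the coloring, up to the change of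
base point along the projection of `γ_r`, a loop in the quandle space. It remains to see that
loops act trivially on the class of a colored diagram
(`baseChange_homotopic_of_height_eq_zero`). Appending a letter `z` to the labels is a homotopy
`suffix z` of the quandle space from the identity to the action of the inner automorphism
`x ↦ x * z`. The map of the diagram lifts to the covering with fibre `Inn X`, and its values are in
the union of the cubes. A point of a cube with the label `(g; x₁, …, x_n)` acts on the whole quandle
space: first by `g`, then by the homotopies `suffix x₁, …, suffix x_n`. The vertex of the quandle
space is thereby carried to the corresponding point of the cube `(x₁, …, x_n)`. Hence, applied to the
points of a loop `γ`, this is a free homotopy from the map of the diagram to itself that runs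
through `γ` on the boundary of the square. This construction does not extend to pairs of points of attached
balls, as the quandle space has no cells that are products of two balls. Therefore the diagram has to
stay in the union of the cubes, while `γ` is arbitrary.
-/

noncomputable section

namespace QuandleHomotopy

universe u v

/-! ### Second homotopy groups, covering maps and the change of base point -/

section Loops

variable {E Z : Type*} [TopologicalSpace E] [TopologicalSpace Z]

theorem isPreconnected_cube_boundary : IsPreconnected (Cube.boundary (Fin 2)) := by
  have side : ∀ (k : Fin 2) (c : I), IsPreconnected {z : Fin 2 → I | z k = c} := by
    intro k c
    have : {z : Fin 2 → I | z k = c} = Set.range fun z : Fin 2 → I => Function.update z k c := by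
      ext z
      constructor
      · rintro rfl
        exact ⟨z, Function.update_eq_self k z⟩
      · rintro ⟨w, rfl⟩
        simp
    rw [this]
    exact isPreconnected_range (by fun_prop)
  have e : Cube.boundary (Fin 2) =
      (({z | z 0 = 0} ∪ {z | z 1 = 0}) ∪ {z | z 0 = 1}) ∪ {z | z 1 = 1} := by
    ext z
    simp only [Cube.boundary, Set.mem_ofPred_eq, Fin.exists_fin_two, Set.mem_union]
    tauto
  rw [e]
  refine .union ![1, 1] ?_ ?_ (.union ![1, 0] ?_ ?_ (.union ![0, 0] ?_ ?_ (side 0 0) (side 1 0))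
    (side 0 1)) (side 1 1) <;> simp

/-- A covering map lifts a map of pairs `(I², ∂I²) → (Z, p e)` to the base point `e`: the lift is
constant on `∂I²`, since `∂I²` is connected. -/
theorem exists_genLoop_lift {p : C(E, Z)} (hp : IsCoveringMap p) (e : E)
    (f : Ω^ (Fin 2) Z (p e)) : ∃ g : Ω^ (Fin 2) E e, mapLoop p g = f := by
  have h0 : (0 : Fin 2 → I) ∈ Cube.boundary (Fin 2) := ⟨0, .inl rfl⟩
  -- the square is regarded as a homotopy of paths that starts with the constant path
  let H : C(I × I, Z) := f.1.comp ⟨fun q => ![q.1, q.2], by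
    refine continuous_pi fun k => ?_
    fin_cases k
    exacts [continuous_fst, continuous_snd]⟩
  have H0 : ∀ a, H (0, a) = p (ContinuousMap.const I e a) := fun a => f.2 _ ⟨0, .inl rfl⟩
  obtain ⟨G, hG, hG0⟩ : ∃ G : C(I × I, E), p ∘ G = H ∧ ∀ a, G (0, a) = e :=
    ⟨_, hp.liftHomotopy_lifts H (.const I e) H0, hp.liftHomotopy_zero H (.const I e) H0⟩
  let F : C(Fin 2 → I, E) := G.comp ⟨fun z => (z 0, z 1), by fun_prop⟩
  have hF : ∀ z, p (F z) = f z := fun z => by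
    refine (congrFun hG (z 0, z 1)).trans ?_
    refine congrArg f (funext fun k => ?_)
    fin_cases k <;> rfl
  refine ⟨⟨F, fun z hz => ?_⟩, ?_⟩
  · have hF0 : F 0 = e := hG0 0
    rw [← hF0]
    refine hp.constOn_of_comp isPreconnected_cube_boundary F.continuous.continuousOn ?_ hz h0
    intro a ha b hb
    exact (hF a).trans ((f.2 a ha).trans ((f.2 b hb).symm.trans (hF b).symm))
  · ext z
    exact hF z

theorem homotopic_mapLoop_iff {p : C(E, Z)} (hp : IsCoveringMap p) {e : E}
    (f g : Ω^ (Fin 2) E e) :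
    GenLoop.Homotopic (mapLoop p f) (mapLoop p g) ↔ GenLoop.Homotopic f g := by
  have h0 : (0 : Fin 2 → I) ∈ Cube.boundary (Fin 2) := ⟨0, .inl rfl⟩
  exact (hp.homotopicRel_iff_comp ⟨0, h0, (f.2 _ h0).trans (g.2 _ h0).symm⟩).symm

theorem mapLoop_transAt (p : C(E, Z)) {e : E} (i : Fin 2) (f g : Ω^ (Fin 2) E e) :
    mapLoop p (GenLoop.transAt i f g) = GenLoop.transAt i (mapLoop p f) (mapLoop p g) := by
  ext z
  change p (GenLoop.transAt i f g z) = _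
  simp only [GenLoop.transAt, GenLoop.coe_copy]
  split_ifs <;> rfl

/-- A covering map induces an isomorphism of second homotopy groups. -/
def piTwoEquiv {p : C(E, Z)} (hp : IsCoveringMap p) (e : E) : π_ 2 E e ≃* π_ 2 Z (p e) :=
  MulEquiv.ofBijective
    (MonoidHom.mk' (M := π_ 2 E e) (G := π_ 2 Z (p e))
      (Quotient.map (mapLoop p) fun f g h => (homotopic_mapLoop_iff hp f g).2 h) (by
        rintro ⟨f⟩ ⟨g⟩
        refine (congrArg (Quotient.map (mapLoop p) _)
          (HomotopyGroup.mul_spec (i := (0 : Fin 2)))).trans ?_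
        refine Eq.trans ?_ (HomotopyGroup.mul_spec (i := (0 : Fin 2))).symm
        exact congrArg (Quotient.mk _) (mapLoop_transAt p 0 g f)))
    ⟨by
      rintro ⟨f⟩ ⟨g⟩ h
      exact Quotient.sound ((homotopic_mapLoop_iff hp f g).1 (Quotient.exact h)), by
      rintro ⟨f⟩
      obtain ⟨g, hg⟩ := exists_genLoop_lift hp e f
      exact ⟨⟦g⟧, congrArg (Quotient.mk _) hg⟩⟩

theorem mapLoop_baseChange (p : C(E, Z)) {e e' : E} (γ : Path e e') (f : Ω^ (Fin 2) E e) :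
    mapLoop p (baseChange γ f) = baseChange (γ.map p.continuous) (mapLoop p f) := by
  ext z
  change p (if _ then _ else _) = if _ then _ else _
  split_ifs <;> rfl

/-- A loop `γ` acts trivially on the class of `f` if there is a free homotopy from `f` to `f`
that runs through `γ` on `∂I²`. -/
theorem baseChange_homotopic {x : Z} (γ : Path x x) (f : Ω^ (Fin 2) Z x)
    (H : C(I × (Fin 2 → I), Z)) (H0 : ∀ z, H (0, z) = f z) (H1 : ∀ z, H (1, z) = f z)
    (hγ : ∀ u, ∀ z ∈ Cube.boundary (Fin 2), H (u, z) = γ u) :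
    GenLoop.Homotopic (baseChange γ f) f := by
  -- the cube is enlarged around its centre by the factor `1 + u`, and cut off outside
  let w : I → (Fin 2 → I) → Fin 2 → I := fun u z k => toI ((1 + u) * (z k : ℝ) - u / 2)
  have w_bdry : ∀ u, ∀ z ∈ Cube.boundary (Fin 2), w u z ∈ Cube.boundary (Fin 2) := by
    rintro u z ⟨k, hk⟩
    have hu := u.2.1
    refine ⟨k, hk.imp (fun h => ?_) fun h => ?_⟩
    · refine Set.projIcc_of_le_left _ ?_
      rw [h]; simp; linarith
    · refine Set.projIcc_of_right_le _ ?_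
      rw [h]; simp; linarith
  have w_zero : ∀ z, w 0 z = z := fun z => funext fun k => toI_of_eq _ (by simp)
  have hw : Continuous fun q : I × (Fin 2 → I) => w q.1 q.2 :=
    continuous_pi fun k => continuous_toI.comp (by fun_prop)
  have w_far : ∀ z, 1 / 2 ≤ depth z → w 1 z ∈ Cube.boundary (Fin 2) := by
    intro z hz
    have key : ∀ k, 1 / 2 ≤ |2 * (z k : ℝ) - 1| → w 1 z ∈ Cube.boundary (Fin 2) := by
      intro k hk
      refine ⟨k, (le_abs.1 hk).symm.imp (fun h => ?_) fun h => ?_⟩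
      · refine Set.projIcc_of_le_left _ ?_
        rw [Set.Icc.coe_one]; linarith
      · refine Set.projIcc_of_right_le _ ?_
        rw [Set.Icc.coe_one]; linarith
    rcases le_max_iff.1 hz with h | h
    exacts [key 0 h, key 1 h]
  have depth_bdry : ∀ z ∈ Cube.boundary (Fin 2), 1 ≤ depth z := by
    rintro z ⟨k, hk⟩
    have hk' : |2 * (z k : ℝ) - 1| = 1 := by
      rcases hk with hk | hk <;> rw [hk] <;> norm_num
    fin_cases k
    · exact hk'.symm.le.trans (le_max_left _ _)
    · exact hk'.symm.le.trans (le_max_right _ _)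
  have d1 : ∀ z, 1 ≤ depth z → toI (2 * depth z - 1) = 1 := fun z hz =>
    Set.projIcc_of_right_le _ (by linarith)
  have d0 : ∀ z, depth z ≤ 1 / 2 → toI (2 * depth z - 1) = 0 := fun z hz =>
    Set.projIcc_of_le_left _ (by linarith)
  have hd : Continuous fun z => toI (2 * depth z - 1) :=
    continuous_toI.comp ((continuous_const.mul continuous_depth).sub continuous_const)
  have bc : ∀ z, baseChange γ f z = H (toI (2 * depth z - 1), w 1 z) := by
    intro z
    change (if depth z ≤ 1 / 2 then _ else _) = _
    split_ifs with h
    · rw [d0 z h, H0]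
      refine congrArg f (funext fun k => congrArg toI ?_)
      rw [Set.Icc.coe_one]; ring
    · exact (hγ _ _ (w_far z (not_le.1 h).le)).symm
  let f' : Ω^ (Fin 2) Z x := ⟨⟨fun z => f (w 1 z), f.1.continuous.comp
    (hw.comp (by fun_prop : Continuous fun z : Fin 2 → I => ((1 : I), z)))⟩,
    fun z hz => f.2 _ (w_bdry 1 z hz)⟩
  -- both parts of `baseChange γ f` are values of `H`, as `w 1` maps the outer part to the boundary;
  -- the time in `H` is then raised to `1`
  have A : GenLoop.Homotopic (baseChange γ f) f' := by
    refine ⟨⟨⟨⟨fun q => H (max q.1 (toI (2 * depth q.2 - 1)), w 1 q.2), ?_⟩, ?_, ?_⟩, ?_⟩⟩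
    · refine H.continuous.comp ((continuous_fst.max (hd.comp continuous_snd)).prodMk
        (hw.comp (continuous_const.prodMk continuous_snd)))
    · intro z
      change H (max 0 _, _) = baseChange γ f z
      rw [bc, max_eq_right unitInterval.nonneg']
    · intro z
      change H (max 1 _, _) = f (w 1 z)
      rw [max_eq_left unitInterval.le_one', H1]
    · intro u z hz
      change H (max u _, _) = baseChange γ f z
      rw [bc, d1 z (depth_bdry z hz), max_eq_right unitInterval.le_one']
  have B : GenLoop.Homotopic f f' := by
    refine ⟨⟨⟨⟨fun q => f (w q.1 q.2), f.1.continuous.comp hw⟩, ?_, ?_⟩, ?_⟩⟩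
    · intro z
      change f (w 0 z) = f z
      rw [w_zero]
    · intro z
      rfl
    · intro u z hz
      change f (w u z) = f z
      exact (f.2 _ (w_bdry u z hz)).trans (f.2 _ hz).symm
  exact A.trans B.symm

end Loops

/-! ### Ordered products over the letters of a label -/

section OrderedProduct

variable {X : Type u} {M : Type*} [Monoid M]

/-- The product `F(x_n, t_n) ⋯ F(x_1, t_1)` attached to a point `t` of the cube with the letters
`x`. The factors are ordered such that, for a left action, the first letter acts first. -/
def orderedProd (F : X → I → M) : {n : ℕ} → (Fin n → X) → (Fin n → I) → M
  | 0, _, _ => 1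
  | _ + 1, x, t => orderedProd F (Fin.tail x) (Fin.tail t) * F (x 0) (t 0)

theorem orderedProd_succ (F : X → I → M) {n : ℕ} (x : Fin (n + 1) → X) (t : Fin (n + 1) → I) :
    orderedProd F x t = orderedProd F (Fin.tail x) (Fin.tail t) * F (x 0) (t 0) := rfl

theorem orderedProd_last (F : X → I → M) {n : ℕ} (x : Fin (n + 1) → X)
    (t : Fin (n + 1) → I) : orderedProd F x t =
      F (x (Fin.last n)) (t (Fin.last n)) * orderedProd F (Fin.init x) (Fin.init t) := by
  induction n with
  | zero => exact (one_mul _).trans (mul_one _).symm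
  | succ n ih =>
    rw [orderedProd_succ, ih, mul_assoc]
    rfl

theorem orderedProd_congr {F : X → I → M} {n : ℕ}
    {x : Fin n → X} {t t' : Fin n → I} (h : ∀ l, F (x l) (t l) = F (x l) (t' l)) :
    orderedProd F x t = orderedProd F x t' := by
  induction n with
  | zero => rfl
  | succ n ih =>
    rw [orderedProd_succ, orderedProd_succ, h 0,
      ih (x := Fin.tail x) (t := Fin.tail t) (t' := Fin.tail t') fun l => h l.succ]

theorem coface_same {n : ℕ} (i : Fin (n + 1)) (ε : Bool) (t : Fin n → I) :
    coface i ε t i = if ε = true then 1 else 0 := Fin.insertNth_apply_same ..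

theorem coface_succAbove {n : ℕ} (i : Fin (n + 1)) (ε : Bool) (t : Fin n → I) (j : Fin n) :
    coface i ε t (i.succAbove j) = t j := Fin.insertNth_apply_succAbove ..

theorem eq_coface_iff {n : ℕ} {i : Fin (n + 1)} {ε : Bool} {t : Fin n → I}
    {t' : Fin (n + 1) → I} :
    t' = coface i ε t ↔ t' i = (if ε = true then 1 else 0) ∧ ∀ j, t' (i.succAbove j) = t j :=
  Fin.eq_insertNth_iff.trans (and_congr_right fun _ => funext_iff)

theorem tail_coface_zero {n : ℕ} (ε : Bool) (t : Fin n → I) :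
    Fin.tail (coface 0 ε t) = t := funext fun j => coface_succAbove 0 ε t j

theorem coface_succ_zero {n : ℕ} (i : Fin (n + 1)) (ε : Bool) (t : Fin (n + 1) → I) :
    coface i.succ ε t 0 = t 0 := coface_succAbove i.succ ε t 0

theorem tail_coface_succ {n : ℕ} (i : Fin (n + 1)) (ε : Bool) (t : Fin (n + 1) → I) :
    Fin.tail (coface i.succ ε t) = coface i ε (Fin.tail t) := by
  rw [eq_coface_iff]
  refine ⟨coface_same i.succ ε t, fun j => ?_⟩
  rw [Fin.tail, ← Fin.succ_succAbove_succ, coface_succAbove, Fin.tail]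

/-- The ordered product is invariant under the folding of a square with two equal letters. -/
theorem orderedProd_swap {F : X → I → M} {n : ℕ} (x : Fin (n + 1) → X) (p : Fin n)
    (t : Fin (n + 1) → I) (hx : x p.castSucc = x p.succ)
    (hc : Commute (F (x p.succ) (t p.castSucc)) (F (x p.succ) (t p.succ))) :
    orderedProd F x (t ∘ Equiv.swap p.castSucc p.succ) = orderedProd F x t := by
  induction n with
  | zero => exact p.elim0
  | succ n ih =>
    cases p using Fin.cases with
    | zero =>
      have e : Fin.tail (Fin.tail (t ∘ Equiv.swap (Fin.castSucc 0) (Fin.succ 0))) =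
          Fin.tail (Fin.tail t) := by
        funext j
        refine congrArg t (Equiv.swap_apply_of_ne_of_ne ?_ ?_)
        · simp
        · simp only [ne_eq, Fin.succ_inj]
          exact Fin.succ_ne_zero _
      have a0 : (t ∘ Equiv.swap (Fin.castSucc 0) (Fin.succ (0 : Fin (n + 1)))) 0 = t 1 :=
        congrArg t (Equiv.swap_apply_left _ _)
      have a1 : Fin.tail (t ∘ Equiv.swap (Fin.castSucc 0) (Fin.succ (0 : Fin (n + 1)))) 0 = t 0 :=
        congrArg t (Equiv.swap_apply_right _ _)
      have hx' : x 0 = Fin.tail x 0 := hx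
      simp only [orderedProd_succ]
      rw [e, a0, a1, hx', mul_assoc, mul_assoc]
      exact congrArg _ hc
    | succ p =>
      have e : Fin.tail (t ∘ Equiv.swap p.succ.castSucc p.succ.succ) =
          Fin.tail t ∘ Equiv.swap p.castSucc p.succ := by
        funext j
        simp only [Fin.tail, Function.comp_apply, ← Fin.succ_castSucc]
        rw [Function.Injective.map_swap (Fin.succ_injective _)]
      have a0 : (t ∘ Equiv.swap p.succ.castSucc p.succ.succ) 0 = t 0 :=
        congrArg t (Equiv.swap_apply_of_ne_of_ne (by simp [Fin.ext_iff]) (by simp [Fin.ext_iff]))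
      rw [orderedProd_succ, orderedProd_succ F x t, e, a0, ih (Fin.tail x) p (Fin.tail t) hx hc]

variable [Quandle X]

theorem faceWord_zero {n : ℕ} (ε : Bool) (x : Fin (n + 1) → X) :
    faceWord 0 ε x = Fin.tail x := by
  funext j
  simp [faceWord, Fin.tail]

theorem faceWord_succ_zero {n : ℕ} (i : Fin (n + 1)) (ε : Bool) (x : Fin (n + 2) → X) :
    faceWord i.succ ε x 0 = if ε = true then x i.succ ◃ x 0 else x 0 := by
  simp [faceWord]

theorem tail_faceWord_succ {n : ℕ} (i : Fin (n + 1)) (ε : Bool) (x : Fin (n + 2) → X) :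
    Fin.tail (faceWord i.succ ε x) = faceWord i ε (Fin.tail x) := by
  funext j
  simp [faceWord, Fin.tail, Fin.succ_succAbove_succ]

/-- The effect of a face map on the ordered product. The commutation rule moves the factor of the
deleted letter to the right end. -/
theorem orderedProd_coface {F : X → I → M} (h0 : ∀ z, F z 0 = 1)
    (h1 : ∀ z w t, F z 1 * F w t = F (z ◃ w) t * F z 1) {n : ℕ} (x : Fin (n + 1) → X)
    (i : Fin (n + 1)) (ε : Bool) (t : Fin n → I) :
    orderedProd F x (coface i ε t) =
      orderedProd F (faceWord i ε x) t * if ε = true then F (x i) 1 else 1 := by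
  induction n with
  | zero =>
    obtain rfl : i = 0 := Fin.fin_one_eq_zero i
    rw [orderedProd_succ, tail_coface_zero, faceWord_zero, coface_same]
    cases ε <;> simp [h0]
  | succ n ih =>
    cases i using Fin.cases with
    | zero =>
      rw [orderedProd_succ, tail_coface_zero, faceWord_zero, coface_same]
      cases ε <;> simp [h0]
    | succ i =>
      rw [orderedProd_succ, tail_coface_succ, coface_succ_zero, ih,
        orderedProd_succ F (faceWord _ _ _), tail_faceWord_succ, faceWord_succ_zero]
      cases ε
      · simp
      · simp only [if_true, mul_assoc]
        rw [← h1]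
        rfl

end OrderedProduct

/-! ### Cells with and without a first entry -/

section Cells

variable {X : Type u} {Y : Type v}

/-- Forgetting the first entry of the labels of the cells. -/
def dropBase : Cells X Y → Cells X PUnit.{1}
  | .inl ⟨c, t⟩ => .inl ⟨⟨c.dim, PUnit.unit, c.word⟩, t⟩
  | .inr ⟨c, t⟩ => .inr ⟨⟨c.k, PUnit.unit, c.word, c.pos, c.rep⟩, t⟩

/-- The first entry of the label of a cell. -/
def cellBase : Cells X Y → Y
  | .inl ⟨c, _⟩ => c.base
  | .inr ⟨c, _⟩ => c.base

/-- Inserting `y` as the first entry of the labels of the cells. -/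
def withBase (y : Y) : Cells X PUnit.{1} → Cells X Y
  | .inl ⟨c, t⟩ => .inl ⟨⟨c.dim, y, c.word⟩, t⟩
  | .inr ⟨c, t⟩ => .inr ⟨⟨c.k, y, c.word, c.pos, c.rep⟩, t⟩

@[simp] theorem dropBase_withBase (y : Y) (c : Cells X PUnit.{1}) :
    dropBase (withBase y c) = c := by rcases c with ⟨c, t⟩ | ⟨c, t⟩ <;> rfl

@[simp] theorem cellBase_withBase (y : Y) (c : Cells X PUnit.{1}) :
    cellBase (withBase y c) = y := by rcases c with ⟨c, t⟩ | ⟨c, t⟩ <;> rfl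

@[simp] theorem withBase_dropBase (a : Cells X Y) : withBase (cellBase a) (dropBase a) = a := by
  rcases a with ⟨c, t⟩ | ⟨c, t⟩ <;> rfl

theorem continuous_dropBase : Continuous (dropBase : Cells X Y → _) := by
  refine continuous_sum_dom.2 ⟨continuous_sigma fun c => ?_, continuous_sigma fun c => ?_⟩
  · exact continuous_inl.comp
      (continuous_sigmaMk (ι := CubeLabel X PUnit.{1}) (i := ⟨c.dim, PUnit.unit, c.word⟩))
  · exact continuous_inr.comp
      (continuous_sigmaMk (ι := PrismLabel X PUnit.{1})
        (i := ⟨c.k, PUnit.unit, c.word, c.pos, c.rep⟩))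

theorem continuous_withBase (y : Y) : Continuous (withBase (X := X) y) := by
  refine continuous_sum_dom.2 ⟨continuous_sigma fun c => ?_, continuous_sigma fun c => ?_⟩
  · exact continuous_inl.comp
      (continuous_sigmaMk (ι := CubeLabel X Y) (i := ⟨c.dim, y, c.word⟩))
  · exact continuous_inr.comp
      (continuous_sigmaMk (ι := PrismLabel X Y) (i := ⟨c.k, y, c.word, c.pos, c.rep⟩))

theorem eventually_cellBase_eq (a : Cells X Y) : ∀ᶠ a' in 𝓝 a, cellBase a' = cellBase a := by
  rcases a with ⟨c, t⟩ | ⟨c, t⟩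
  · rw [nhds_inl, Sigma.nhds_mk]
    exact Filter.eventually_map.2 (Filter.eventually_map.2 (.of_forall fun _ => rfl))
  · rw [nhds_inr, Sigma.nhds_mk]
    exact Filter.eventually_map.2 (Filter.eventually_map.2 (.of_forall fun _ => rfl))

variable [Quandle X] (A : QuandleSet X Y)

theorem Glue.dropBase {A : QuandleSet X Y} {a b : Cells X Y} (h : Glue A a b) :
    Glue (QuandleSet.point X) (dropBase a) (dropBase b) := by
  cases h with
  | face y x i ε t => exact Glue.face (A := QuandleSet.point X) PUnit.unit x i ε t
  | bottom c t =>
    exact Glue.bottom (A := QuandleSet.point X) ⟨c.k, PUnit.unit, c.word, c.pos, c.rep⟩ t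
  | side y x p hp j ε q hq h₀ h₁ t s =>
    exact Glue.side (A := QuandleSet.point X) PUnit.unit x p hp j ε q hq h₀ h₁ t s
  | fold c t s ht =>
    exact Glue.fold (A := QuandleSet.point X) ⟨c.k, PUnit.unit, c.word, c.pos, c.rep⟩ t s ht
  | apex c t t' ht =>
    exact Glue.apex (A := QuandleSet.point X) ⟨c.k, PUnit.unit, c.word, c.pos, c.rep⟩ t t' ht

/-- A gluing of cells without first entries lifts to the cells with any given first entry of the
source. -/
theorem Glue.exists_withBase {c c' : Cells X PUnit.{1}} (h : Glue (QuandleSet.point X) c c')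
    (y : Y) : ∃ y', Glue A (withBase y c) (withBase y' c') := by
  cases h with
  | face _ x i ε t => exact ⟨_, Glue.face y x i ε t⟩
  | bottom c t => exact ⟨y, Glue.bottom ⟨c.k, y, c.word, c.pos, c.rep⟩ t⟩
  | side _ x p hp j ε q hq h₀ h₁ t s => exact ⟨_, Glue.side y x p hp j ε q hq h₀ h₁ t s⟩
  | fold c t s ht => exact ⟨y, Glue.fold ⟨c.k, y, c.word, c.pos, c.rep⟩ t s ht⟩
  | apex c t t' ht => exact ⟨y, Glue.apex ⟨c.k, y, c.word, c.pos, c.rep⟩ t t' ht⟩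

/-- The projection of a quandle space with coefficients onto the quandle space, which forgets the
first entry of the labels. -/
def projPoint : C(QSpace A, QuandleSpace X) where
  toFun := Quot.map dropBase fun _ _ h => h.dropBase
  continuous_toFun := continuous_quot_lift _ (continuous_quot_mk.comp continuous_dropBase)

theorem projPoint_regular : projPoint (QuandleSet.regular X) = proj X := by
  ext q
  obtain ⟨c, rfl⟩ := Quot.exists_rep q
  rcases c with ⟨c, t⟩ | ⟨c, t⟩ <;> rfl

theorem isQuotientMap_mk : Topology.IsQuotientMap (QSpace.mk A) := isQuotientMap_quot_mk

theorem projPoint_mk (a : Cells X Y) :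
    projPoint A (QSpace.mk A a) = QSpace.mk _ (dropBase a) := rfl

theorem mk_eq_of_glue {A : QuandleSet X Y} {a b : Cells X Y} (h : Glue A a b) :
    QSpace.mk A a = QSpace.mk A b := Quot.sound h

end Cells

/-! ### Local trivializations of the projection -/

section EvenlyCovered

variable {X : Type u} {Y : Type v} [Quandle X] (A : QuandleSet X Y)

/-- A saturated open set `V` of cells, with a locally constant family `w` of permutations of `Y`
on `V` such that `w c y` is invariant under the gluing. Such a family trivializes the projection
over the image of `V`. -/
structure LocalTrivialization where
  V : Set (Cells X PUnit.{1})
  w : Cells X PUnit.{1} → Equiv.Perm Y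
  isOpen : IsOpen V
  saturated : ∀ c c', Glue (QuandleSet.point X) c c' → (c ∈ V ↔ c' ∈ V)
  invariant : ∀ a b, Glue A a b → dropBase a ∈ V →
    w (dropBase a) (cellBase a) = w (dropBase b) (cellBase b)
  eventually_eq : ∀ c ∈ V, ∀ᶠ c' in 𝓝 c, w c' = w c

namespace LocalTrivialization

variable {A} (T : LocalTrivialization A)

/-- The image of `V` in the quandle space. -/
def image : Set (QuandleSpace X) :=
  {q | Quot.lift (· ∈ T.V) (fun c c' h => propext (T.saturated c c' h)) q}

theorem isOpen_image : IsOpen T.image :=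
  (isQuotientMap_mk _).isOpen_preimage.1 T.isOpen

open Classical in
/-- The coordinate in `Y` of a point over the image of `V`, with the value `y₀` elsewhere. -/
def fiberCoord (y₀ : Y) : QSpace A → Y :=
  Quot.lift (fun a => if dropBase a ∈ T.V then T.w (dropBase a) (cellBase a) else y₀) (by
    intro a b h
    have hs := T.saturated _ _ h.dropBase
    by_cases ha : dropBase a ∈ T.V
    · simp only [if_pos ha, if_pos (hs.1 ha), T.invariant a b h ha]
    · simp only [if_neg ha, if_neg fun hb => ha (hs.2 hb)])

open Classical in
/-- The section through the points with coordinate `r`, with a constant value outside the image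
of `V`. -/
def localSection (y₀ r : Y) : QuandleSpace X → QSpace A :=
  Quot.lift (fun c => if c ∈ T.V then QSpace.mk A (withBase ((T.w c).symm r) c) else vtx A y₀) (by
    intro c c' h
    have hs := T.saturated _ _ h
    by_cases hc : c ∈ T.V
    · simp only [if_pos hc, if_pos (hs.1 hc)]
      obtain ⟨y', h'⟩ := h.exists_withBase A ((T.w c).symm r)
      have := T.invariant _ _ h' (by simpa using hc)
      simp only [dropBase_withBase, cellBase_withBase, Equiv.apply_symm_apply] at this
      rw [(Equiv.eq_symm_apply _).2 this.symm] at h'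
      exact mk_eq_of_glue h'
    · simp only [if_neg hc, if_neg fun hb => hc (hs.2 hb)])

variable (y₀ : Y)

theorem fiberCoord_mk {a : Cells X Y} (ha : dropBase a ∈ T.V) :
    T.fiberCoord y₀ (QSpace.mk A a) = T.w (dropBase a) (cellBase a) := if_pos ha

theorem localSection_mk (r : Y) {c : Cells X PUnit.{1}} (hc : c ∈ T.V) :
    T.localSection y₀ r (QSpace.mk _ c) = QSpace.mk A (withBase ((T.w c).symm r) c) := if_pos hc

theorem continuousOn_fiberCoord [TopologicalSpace Y] :
    ContinuousOn (T.fiberCoord y₀) (projPoint A ⁻¹' T.image) := by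
  rw [(isQuotientMap_mk A).continuousOn_isOpen_iff
    (T.isOpen_image.preimage (projPoint A).continuous)]
  intro a ha
  refine ContinuousAt.continuousWithinAt ?_
  have h1 := continuous_dropBase.continuousAt.eventually (T.eventually_eq _ ha)
  have h2 := continuous_dropBase.continuousAt.eventually (T.isOpen.mem_nhds ha)
  refine continuousAt_const.congr (f := fun _ => T.w (dropBase a) (cellBase a)) ?_
  filter_upwards [h1, h2, eventually_cellBase_eq a] with a' e1 e2 e3
  rw [Function.comp_apply, fiberCoord_mk T y₀ e2, e1, e3]

theorem continuousOn_localSection (r : Y) : ContinuousOn (T.localSection y₀ r) T.image := by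
  rw [(isQuotientMap_mk _).continuousOn_isOpen_iff T.isOpen_image]
  intro c hc
  refine ContinuousAt.continuousWithinAt ?_
  refine ((QSpace.continuous_mk A).comp (continuous_withBase ((T.w c).symm r))).continuousAt.congr ?_
  filter_upwards [T.eventually_eq _ hc, T.isOpen.mem_nhds hc] with c' e1 e2
  rw [Function.comp_apply, Function.comp_apply, localSection_mk T y₀ r e2, e1]

theorem projPoint_localSection (r : Y) {q : QuandleSpace X} (hq : q ∈ T.image) :
    projPoint A (T.localSection y₀ r q) = q := by
  obtain ⟨c, rfl⟩ := Quot.exists_rep q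
  refine (congrArg _ (T.localSection_mk y₀ r hq)).trans ?_
  rw [projPoint_mk, dropBase_withBase]
  rfl

theorem fiberCoord_localSection (r : Y) {q : QuandleSpace X} (hq : q ∈ T.image) :
    T.fiberCoord y₀ (T.localSection y₀ r q) = r := by
  obtain ⟨c, rfl⟩ := Quot.exists_rep q
  refine (congrArg _ (T.localSection_mk y₀ r hq)).trans ?_
  rw [fiberCoord_mk T y₀ (by rw [dropBase_withBase]; exact hq), dropBase_withBase, cellBase_withBase,
    Equiv.apply_symm_apply]

theorem localSection_fiberCoord {z : QSpace A} (hz : projPoint A z ∈ T.image) :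
    T.localSection y₀ (T.fiberCoord y₀ z) (projPoint A z) = z := by
  obtain ⟨a, rfl⟩ := Quot.exists_rep z
  refine (T.localSection_mk y₀ _ hz).trans ?_
  refine Eq.trans ?_ (congrArg (QSpace.mk A) (withBase_dropBase a))
  congr 2
  rw [Equiv.symm_apply_eq]
  exact T.fiberCoord_mk y₀ hz

theorem isEvenlyCovered [Nonempty Y] [TopologicalSpace Y] [DiscreteTopology Y] {q : QuandleSpace X}
    (hq : q ∈ T.image) : IsEvenlyCovered (projPoint A) q Y := by
  obtain ⟨y₀⟩ := ‹Nonempty Y›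
  refine ⟨inferInstance, T.image, hq, T.isOpen_image,
    T.isOpen_image.preimage (projPoint A).continuous, ?_⟩
  refine ⟨{ toFun := fun z => (⟨projPoint A z, z.2⟩, T.fiberCoord y₀ z)
            invFun := fun r => ⟨T.localSection y₀ r.2 r.1, ?_⟩
            left_inv := ?_
            right_inv := ?_
            continuous_toFun := ?_
            continuous_invFun := ?_ }, ?_⟩
  · rw [Set.mem_preimage, T.projPoint_localSection y₀ _ r.1.2]
    exact r.1.2
  · intro z
    exact Subtype.ext (T.localSection_fiberCoord y₀ z.2)
  · rintro ⟨⟨q, hq⟩, r⟩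
    exact Prod.ext (Subtype.ext (T.projPoint_localSection y₀ r hq))
      (T.fiberCoord_localSection y₀ r hq)
  · exact (Continuous.subtype_mk ((projPoint A).continuous.comp continuous_subtype_val) _).prodMk
      (T.continuousOn_fiberCoord y₀).domRestrict
  · refine Continuous.subtype_mk ?_ _
    refine continuous_prod_of_discrete_right.2 fun r => ?_
    exact (T.continuousOn_localSection y₀ r).domRestrict
  · intro z
    rfl

end LocalTrivialization

end EvenlyCovered

/-! ### The projection is a covering map -/

section Stars

variable {X : Type u} {Y : Type v} [Quandle X] (A : QuandleSet X Y)

open Classical in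
/-- The action of the letter `z`, switched on when the coordinate `t` passes the threshold `τ`. The
ordered product of these permutations at a point of a cube carries the first entry of the label of
the cube to the label of a vertex: the one to which the thresholds assign the point. -/
def actAbove (τ : I) (z : X) (t : I) : Equiv.Perm Y := if τ < t then A.act z else 1

theorem actAbove_zero (τ : I) (z : X) : actAbove A τ z 0 = 1 :=
  if_neg (not_lt.2 unitInterval.nonneg')

theorem actAbove_one {τ : I} (hτ : τ < 1) (z : X) : actAbove A τ z 1 = A.act z := if_pos hτ

theorem actAbove_comm {τ : I} (hτ : τ < 1) (z w : X) (t : I) :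
    actAbove A τ z 1 * actAbove A τ w t = actAbove A τ (z ◃ w) t * actAbove A τ z 1 := by
  rw [actAbove_one A hτ]
  unfold actAbove
  split_ifs
  · exact Equiv.ext fun y => A.act_act w z y
  · simp

/-- The label of the vertex to which a point is assigned does not depend on the cube in which the
point is represented. -/
theorem orderedProd_actAbove_coface {τ : I} (hτ : τ < 1) {n : ℕ} (x : Fin (n + 1) → X)
    (i : Fin (n + 1)) (ε : Bool) (t : Fin n → I) (y : Y) :
    orderedProd (actAbove A τ) x (coface i ε t) y =
      orderedProd (actAbove A τ) (faceWord i ε x) t (faceBase A i ε y x) := by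
  rw [orderedProd_coface (actAbove_zero A τ) (actAbove_comm A hτ), faceBase, actAbove_one A hτ]
  cases ε <;> rfl

theorem actAbove_commute (τ : I) (z : X) (s t : I) :
    Commute (actAbove A τ z s) (actAbove A τ z t) := by
  unfold actAbove
  split_ifs
  exacts [.refl _, .one_right _, .one_left _, .refl _]

theorem eventually_orderedProd_actAbove_eq {τ : I} {n : ℕ} (x : Fin n → X) {t : Fin n → I}
    (ht : ∀ l, t l ≠ τ) :
    ∀ᶠ t' in 𝓝 t, orderedProd (actAbove A τ) x t' = orderedProd (actAbove A τ) x t := by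
  have : ∀ᶠ t' in 𝓝 t, ∀ l, (τ < t' l ↔ τ < t l) := by
    refine Filter.eventually_all.2 fun l => ?_
    have hc : Filter.Tendsto (fun t' : Fin n → I => t' l) (𝓝 t) (𝓝 (t l)) :=
      (continuous_apply l).continuousAt
    rcases lt_or_gt_of_ne (ht l) with h | h
    · filter_upwards [hc.eventually (gt_mem_nhds h)] with t' h'
      exact iff_of_false (not_lt.2 h'.le) (not_lt.2 h.le)
    · filter_upwards [hc.eventually (lt_mem_nhds h)] with t' h'
      exact iff_of_true h' h
  filter_upwards [this] with t' h'
  refine orderedProd_congr fun l => ?_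
  simp only [actAbove, h' l]

theorem coface_ne_iff {τ : I} (h0 : 0 < τ) (h1 : τ < 1) {n : ℕ} (i : Fin (n + 1)) (ε : Bool)
    (t : Fin n → I) : (∀ l, coface i ε t l ≠ τ) ↔ ∀ l, t l ≠ τ := by
  rw [Fin.forall_iff_succAbove i, coface_same]
  simp only [coface_succAbove]
  refine and_iff_right ?_
  cases ε
  · exact h0.ne
  · exact h1.ne'

theorem isOpen_forall_ne {n : ℕ} (τ : I) : IsOpen {t : Fin n → I | ∀ l, t l ≠ τ} := by
  simp only [Set.ofPred_forall]
  exact isOpen_iInter_of_finite fun l => isOpen_ne_fun (continuous_apply l) continuous_const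

/-- Points none of whose cube coordinates is equal to `τ`, away from the centres of the balls. -/
def InVertexStar (τ : I) : Cells X PUnit.{1} → Prop
  | .inl ⟨_, t⟩ => ∀ l, t l ≠ τ
  | .inr ⟨_, t, s⟩ => s ≠ 1 ∧ ∀ l, t l ≠ τ

/-- The permutation that carries the first entry of the label to the label of the nearest vertex,
where `τ` is the boundary between `0` and `1`. -/
def vertexPerm (τ : I) : Cells X PUnit.{1} → Equiv.Perm Y
  | .inl ⟨c, t⟩ => orderedProd (actAbove A τ) c.word t
  | .inr ⟨c, t, _⟩ => orderedProd (actAbove A τ) c.word t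

/-- The open star of the vertices trivializes the projection: every point of it is assigned to a
vertex. -/
def vertexStar {τ : I} (h0 : 0 < τ) (h1 : τ < 1) : LocalTrivialization A where
  V := {c | InVertexStar τ c}
  w := vertexPerm A τ
  isOpen := by
    refine isOpen_sum_iff.2 ⟨isOpen_sigma_iff.2 fun c => ?_, isOpen_sigma_iff.2 fun c => ?_⟩
    · exact isOpen_forall_ne τ
    · exact (isOpen_ne_fun continuous_snd continuous_const).inter
        ((isOpen_forall_ne τ).preimage continuous_fst)
  saturated := by
    intro c c' h
    cases h with
    | face y x i ε t => exact coface_ne_iff h0 h1 i ε t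
    | bottom c t => exact and_iff_right zero_ne_one
    | side y x p hp j ε q hq h₀ h₁ t s => exact and_congr_right fun _ => coface_ne_iff h0 h1 j ε t
    | fold c t s ht =>
      exact and_congr_right fun _ =>
        ((Equiv.swap c.pos.castSucc c.pos.succ).forall_congr_left
          (p := fun l => t l ≠ τ)).trans (by simp)
    | apex c t t' ht => exact iff_of_false (fun h => h.1 rfl) fun h => h.1 rfl
  invariant := by
    intro a b h hV
    cases h with
    | face y x i ε t => exact orderedProd_actAbove_coface A h1 x i ε t y
    | bottom c t => rfl
    | side y x p hp j ε q hq h₀ h₁ t s => exact orderedProd_actAbove_coface A h1 x j ε t y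
    | fold c t s ht =>
      exact (congrArg (fun g : Equiv.Perm Y => g c.base)
        (orderedProd_swap c.word c.pos t c.rep (actAbove_commute A τ _ _ _))).symm
    | apex c t t' ht => exact absurd rfl hV.1
  eventually_eq := by
    rintro (⟨c, t⟩ | ⟨c, t, s⟩) hc
    · rw [nhds_inl, Sigma.nhds_mk]
      exact Filter.eventually_map.2 (Filter.eventually_map.2
        (eventually_orderedProd_actAbove_eq A c.word hc))
    · rw [nhds_inr, Sigma.nhds_mk]
      exact Filter.eventually_map.2 (Filter.eventually_map.2
        (continuous_fst.continuousAt.eventually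
          (eventually_orderedProd_actAbove_eq A c.word hc.2)))

/-- Setting the coordinates at a repetition to `0`. -/
def collapse {k : ℕ} (p : Fin (k + 1)) (t : Fin (k + 2) → I) : Fin (k + 2) → I := fun l =>
  if l = p.castSucc ∨ l = p.succ then 0 else t l

theorem collapse_coface {k : ℕ} {p : Fin (k + 2)} {j : Fin (k + 3)} {q : Fin (k + 1)}
    (h₀ : j.succAbove q.castSucc = p.castSucc) (h₁ : j.succAbove q.succ = p.succ) (ε : Bool)
    (t : Fin (k + 2) → I) : collapse p (coface j ε t) = coface j ε (collapse q t) := by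
  rw [eq_coface_iff]
  constructor
  · rw [collapse, if_neg, coface_same]
    rw [← h₀, ← h₁]
    rintro (h | h)
    · exact Fin.succAbove_ne _ _ h.symm
    · exact Fin.succAbove_ne _ _ h.symm
  · intro l
    simp only [collapse, coface_succAbove, ← h₀, ← h₁, Fin.succAbove_right_inj]

theorem collapse_swap {k : ℕ} (p : Fin (k + 1)) (t : Fin (k + 2) → I) :
    collapse p (t ∘ Equiv.swap p.castSucc p.succ) = collapse p t := by
  funext l
  unfold collapse
  split_ifs with h
  · rfl
  · rw [not_or] at h
    exact congrArg t (Equiv.swap_apply_of_ne_of_ne h.1 h.2)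

theorem collapse_congr {k : ℕ} {p : Fin (k + 1)} {t t' : Fin (k + 2) → I}
    (h : ∀ l, l ≠ p.castSucc → l ≠ p.succ → t l = t' l) : collapse p t = collapse p t' := by
  funext l
  unfold collapse
  split_ifs with hl
  · rfl
  · exact h l (fun e => hl (.inl e)) fun e => hl (.inr e)

theorem continuous_collapse {k : ℕ} (p : Fin (k + 1)) : Continuous (collapse p) := by
  refine continuous_pi fun l => ?_
  unfold collapse
  split_ifs
  exacts [continuous_const, continuous_apply l]

/-- Points in the interiors of the balls, none of whose other coordinates is equal to `τ`. -/
def InBallStar (τ : I) : Cells X PUnit.{1} → Prop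
  | .inl _ => False
  | .inr ⟨c, t, s⟩ => s ≠ 0 ∧ ∀ l, collapse c.pos t l ≠ τ

/-- The permutation that carries the first entry of the label to the label of the nearest vertex in
the directions transverse to the ball, at its corner `(0, 0)`. -/
def ballPerm (τ : I) : Cells X PUnit.{1} → Equiv.Perm Y
  | .inl _ => 1
  | .inr ⟨c, t, _⟩ => orderedProd (actAbove A τ) c.word (collapse c.pos t)

/-- The interiors of the balls, thickened in the transverse directions, trivialize the
projection. -/
def ballStar {τ : I} (h0 : 0 < τ) (h1 : τ < 1) : LocalTrivialization A where
  V := {c | InBallStar τ c}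
  w := ballPerm A τ
  isOpen := by
    refine isOpen_sum_iff.2 ⟨isOpen_sigma_iff.2 fun c => ?_, isOpen_sigma_iff.2 fun c => ?_⟩
    · exact isOpen_empty
    · exact (isOpen_ne_fun continuous_snd continuous_const).inter
        ((isOpen_forall_ne τ).preimage ((continuous_collapse c.pos).comp continuous_fst))
  saturated := by
    intro c c' h
    cases h with
    | face y x i ε t => exact Iff.rfl
    | bottom c t => exact iff_of_false (fun h => h.1 rfl) id
    | side y x p hp j ε q hq h₀ h₁ t s =>
      refine and_congr_right fun _ => ?_
      simp only [collapse_coface h₀ h₁]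
      exact coface_ne_iff h0 h1 j ε _
    | fold c t s ht =>
      refine and_congr_right fun _ => ?_
      simp only [collapse_swap]
    | apex c t t' ht =>
      refine and_congr_right fun _ => ?_
      rw [collapse_congr ht]
  invariant := by
    intro a b h hV
    cases h with
    | face y x i ε t => exact hV.elim
    | bottom c t => exact absurd rfl hV.1
    | side y x p hp j ε q hq h₀ h₁ t s =>
      refine (congrArg (fun t => orderedProd (actAbove A τ) x t y)
        (collapse_coface h₀ h₁ ε t)).trans ?_
      exact orderedProd_actAbove_coface A h1 x j ε _ y
    | fold c t s ht =>
      exact (congrArg (fun t => orderedProd (actAbove A τ) c.word t c.base)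
        (collapse_swap c.pos t)).symm
    | apex c t t' ht =>
      exact congrArg (fun t => orderedProd (actAbove A τ) c.word t c.base)
        (collapse_congr ht)
  eventually_eq := by
    rintro (⟨c, t⟩ | ⟨c, t, s⟩) hc
    · exact hc.elim
    · rw [nhds_inr, Sigma.nhds_mk]
      have hcol : Continuous fun q : (Fin (c.k + 2) → I) × I => collapse c.pos q.1 :=
        (continuous_collapse c.pos).comp continuous_fst
      exact Filter.eventually_map.2 (Filter.eventually_map.2
        ((hcol.tendsto (t, s)).eventually (eventually_orderedProd_actAbove_eq A c.word hc.2)))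

theorem exists_threshold {n : ℕ} (t : Fin n → I) : ∃ τ : I, 0 < τ ∧ τ < 1 ∧ ∀ l, t l ≠ τ := by
  obtain ⟨τ, ⟨h0, h1⟩, h⟩ := ((Set.Ioo_infinite (zero_lt_one (α := I))).sdiff
    (Set.finite_range t)).nonempty
  exact ⟨τ, h0, h1, fun l hl => h ⟨l, hl⟩⟩

/-- Every point has a neighbourhood that trivializes the projection: the threshold `τ` can be
chosen apart from the finitely many coordinates of the point. -/
theorem isCoveringMap_projPoint [Nonempty Y] : IsCoveringMap (projPoint A) := by
  let : TopologicalSpace Y := ⊥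
  have : DiscreteTopology Y := ⟨rfl⟩
  intro q
  suffices IsEvenlyCovered (projPoint A) q Y from IsEvenlyCovered.to_isEvenlyCovered_preimage this
  have cube : ∀ (c : CubeLabel X PUnit.{1}) (t : Fin c.dim → I),
      IsEvenlyCovered (projPoint A) (QSpace.mk _ (.inl ⟨c, t⟩)) Y := by
    intro c t
    obtain ⟨τ, h0, h1, h⟩ := exists_threshold t
    exact (vertexStar A h0 h1).isEvenlyCovered (q := QSpace.mk _ (.inl ⟨c, t⟩)) h
  obtain ⟨⟨c, t⟩ | ⟨c, t, s⟩, rfl⟩ := Quot.exists_rep q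
  · exact cube c t
  · by_cases hs : s = 0
    · subst hs
      have e := mk_eq_of_glue (Glue.bottom (A := QuandleSet.point X) c t)
      exact e.symm.subst (motive := fun q => IsEvenlyCovered (projPoint A) q Y)
        (cube ⟨c.k + 2, c.base, c.word⟩ t)
    · obtain ⟨τ, h0, h1, h⟩ := exists_threshold (collapse c.pos t)
      exact (ballStar A h0 h1).isEvenlyCovered (q := QSpace.mk _ (.inr ⟨c, t, s⟩)) ⟨hs, h⟩

end Stars

/-! ### The action of the inner automorphisms on the quandle space -/

section InnAction

variable {X : Type u} [Quandle X]

theorem Inn.map_act (g : Inn X) (a b : X) :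
    (g : Equiv.Perm X) (a ◃ b) = (g : Equiv.Perm X) a ◃ (g : Equiv.Perm X) b := by
  obtain ⟨g, hg⟩ := g
  induction hg using Subgroup.closure_induction generalizing a b with
  | mem g hg =>
    obtain ⟨c, rfl⟩ := hg
    exact Shelf.self_distrib
  | one => rfl
  | mul g h _ _ ihg ihh =>
    simp only [Equiv.Perm.mul_apply] at ihg ihh ⊢
    rw [ihh, ihg]
  | inv g _ ih =>
    simp only at ih ⊢
    rw [Equiv.Perm.inv_eq_iff_eq, ih]
    simp

/-- The inner automorphism `x ↦ x * z`. -/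
def Inn.gen (z : X) : Inn X := ⟨Rack.act' z, Subgroup.subset_closure ⟨z, rfl⟩⟩

theorem Inn.gen_mul_gen (z w : X) : Inn.gen z * Inn.gen w = Inn.gen (z ◃ w) * Inn.gen z :=
  Subtype.ext (Equiv.ext fun _ => Shelf.self_distrib)

/-- The group of inner automorphisms as a set with an action of the quandle. -/
def QuandleSet.inn (X : Type u) [Quandle X] : QuandleSet X (Inn X) where
  act z := Equiv.mulLeft (Inn.gen z)
  act_act a b g := by
    simp only [Equiv.coe_mulLeft]
    rw [← mul_assoc, Inn.gen_mul_gen, mul_assoc]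

/-- The gluing relation `side`, with its labels and coordinates given up to equality. -/
theorem glue_side {Y : Type v} (A : QuandleSet X Y) {k : ℕ} (y : Y) (x : Fin (k + 3) → X)
    (p : Fin (k + 2)) (hp : x p.castSucc = x p.succ) (j : Fin (k + 3)) (ε : Bool) (q : Fin (k + 1))
    (h₀ : j.succAbove q.castSucc = p.castSucc) (h₁ : j.succAbove q.succ = p.succ)
    (t : Fin (k + 2) → I) (s : I) {t' : Fin (k + 3) → I} {y' : Y} {x' : Fin (k + 2) → X}
    (ht : t' = coface j ε t) (hy : faceBase A j ε y x = y') (hx : faceWord j ε x = x')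
    (hq : x' q.castSucc = x' q.succ) :
    QSpace.mk A (.inr ⟨⟨k + 1, y, x, p, hp⟩, (t', s)⟩) =
      QSpace.mk A (.inr ⟨⟨k, y', x', q, hq⟩, (t, s)⟩) := by
  subst ht hy hx
  exact Quot.sound (Glue.side y x p hp j ε q hq h₀ h₁ t s)

/-- An inner automorphism acts on the cells by acting on the letters. -/
def mapCells (g : Inn X) : Cells X PUnit.{1} → Cells X PUnit.{1}
  | .inl ⟨c, t⟩ => .inl ⟨⟨c.dim, PUnit.unit, fun l => (g : Equiv.Perm X) (c.word l)⟩, t⟩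
  | .inr ⟨c, t⟩ => .inr ⟨⟨c.k, PUnit.unit, fun l => (g : Equiv.Perm X) (c.word l), c.pos,
      congrArg (g : Equiv.Perm X) c.rep⟩, t⟩

theorem continuous_mapCells (g : Inn X) : Continuous (mapCells g) := by
  refine continuous_sum_dom.2 ⟨continuous_sigma fun c => ?_, continuous_sigma fun c => ?_⟩
  · exact continuous_inl.comp (continuous_sigmaMk (ι := CubeLabel X PUnit.{1})
      (i := ⟨c.dim, PUnit.unit, fun l => (g : Equiv.Perm X) (c.word l)⟩))
  · exact continuous_inr.comp (continuous_sigmaMk (ι := PrismLabel X PUnit.{1})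
      (i := ⟨c.k, PUnit.unit, fun l => (g : Equiv.Perm X) (c.word l), c.pos,
        congrArg (g : Equiv.Perm X) c.rep⟩))

theorem faceWord_map (g : Inn X) {n : ℕ} (i : Fin (n + 1)) (ε : Bool) (x : Fin (n + 1) → X) :
    faceWord i ε (fun l => (g : Equiv.Perm X) (x l)) =
      fun l => (g : Equiv.Perm X) (faceWord i ε x l) := by
  funext l
  unfold faceWord
  split_ifs
  · rw [Inn.map_act]
  · rfl

/-- The action of an inner automorphism on the quandle space. -/
def mapSpace (g : Inn X) : C(QuandleSpace X, QuandleSpace X) where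
  toFun := Quot.lift (fun c => QSpace.mk _ (mapCells g c)) (by
    intro c c' h
    cases h with
    | face y x i ε t => exact glue_face _ _ _ i ε t rfl rfl (faceWord_map g i ε x)
    | bottom c t =>
      exact mk_eq_of_glue (Glue.bottom (A := QuandleSet.point X)
        ⟨c.k, PUnit.unit, fun l => (g : Equiv.Perm X) (c.word l), c.pos, _⟩ t)
    | side y x p hp j ε q hq h₀ h₁ t s =>
      exact glue_side _ _ _ p _ j ε q h₀ h₁ t s rfl rfl (faceWord_map g j ε x) _
    | fold c t s ht =>
      exact mk_eq_of_glue (Glue.fold (A := QuandleSet.point X)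
        ⟨c.k, PUnit.unit, fun l => (g : Equiv.Perm X) (c.word l), c.pos, _⟩ t s ht)
    | apex c t t' ht =>
      exact mk_eq_of_glue (Glue.apex (A := QuandleSet.point X)
        ⟨c.k, PUnit.unit, fun l => (g : Equiv.Perm X) (c.word l), c.pos, _⟩ t t' ht))
  continuous_toFun :=
    continuous_quot_lift _ ((QSpace.continuous_mk _).comp (continuous_mapCells g))

theorem mapSpace_one (b : QuandleSpace X) : mapSpace 1 b = b := by
  obtain ⟨⟨c, t⟩ | ⟨c, t⟩, rfl⟩ := Quot.exists_rep b <;> rfl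

theorem mapSpace_mul (g h : Inn X) (b : QuandleSpace X) :
    mapSpace (g * h) b = mapSpace g (mapSpace h b) := by
  obtain ⟨⟨c, t⟩ | ⟨c, t⟩, rfl⟩ := Quot.exists_rep b <;> rfl

theorem mapSpace_basePoint (g : Inn X) : mapSpace g (basePoint X) = basePoint X := by
  change QSpace.mk _ (.inl ⟨⟨0, PUnit.unit, _⟩, _⟩) = QSpace.mk _ (.inl ⟨⟨0, PUnit.unit, _⟩, _⟩)
  congr 4
  exact Subsingleton.elim _ _

end InnAction

/-! ### Appending a letter to the labels -/

section Suffix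

variable {X : Type u}

theorem castSucc_succAbove_last {n : ℕ} (i : Fin (n + 1)) :
    i.castSucc.succAbove (Fin.last n) = Fin.last (n + 1) :=
  Fin.succAbove_of_le_castSucc _ _ (Fin.castSucc_le_castSucc_iff.2 (Fin.le_last i))

theorem coface_castSucc_snoc {n : ℕ} (i : Fin (n + 1)) (ε : Bool) (s : Fin n → I) (t : I) :
    (Fin.snoc (coface i ε s) t : Fin (n + 2) → I) = coface i.castSucc ε (Fin.snoc s t) := by
  rw [eq_coface_iff]
  refine ⟨by rw [Fin.snoc_castSucc, coface_same], fun j => ?_⟩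
  cases j using Fin.lastCases with
  | last => rw [castSucc_succAbove_last, Fin.snoc_last, Fin.snoc_last]
  | cast j =>
    rw [Fin.castSucc_succAbove_castSucc, Fin.snoc_castSucc, Fin.snoc_castSucc, coface_succAbove]

theorem coface_last {n : ℕ} (ε : Bool) (s : Fin n → I) :
    (Fin.snoc s (if ε = true then 1 else 0) : Fin (n + 1) → I) = coface (Fin.last n) ε s := by
  rw [eq_coface_iff]
  refine ⟨Fin.snoc_last .., fun j => ?_⟩
  rw [Fin.succAbove_last, Fin.snoc_castSucc]

theorem snoc_rep {k : ℕ} {x : Fin (k + 2) → X} {p : Fin (k + 1)} (h : x p.castSucc = x p.succ)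
    (z : X) : (Fin.snoc x z : Fin (k + 3) → X) p.castSucc.castSucc =
      (Fin.snoc x z : Fin (k + 3) → X) p.castSucc.succ := by
  rw [Fin.succ_castSucc, Fin.snoc_castSucc, Fin.snoc_castSucc, h]

/-- The label of a degenerate cell with the letter `z` appended. -/
def PrismLabel.snoc (c : PrismLabel X PUnit.{1}) (z : X) : PrismLabel X PUnit.{1} :=
  ⟨c.k + 1, PUnit.unit, Fin.snoc c.word z, c.pos.castSucc, snoc_rep c.rep z⟩

theorem continuous_snoc (n : ℕ) :
    Continuous fun q : (Fin n → I) × I => (Fin.snoc q.1 q.2 : Fin (n + 1) → I) :=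
  Continuous.finSnoc (A := fun _ => I) continuous_fst continuous_snd

/-- The product of a cell with the edge labelled by `z`: the letter `z` is appended to the label
of the cell. -/
def suffixCell (z : X) : Cells X PUnit.{1} → I → Cells X PUnit.{1}
  | .inl ⟨c, s⟩, t => .inl ⟨⟨c.dim + 1, PUnit.unit, Fin.snoc c.word z⟩, Fin.snoc s t⟩
  | .inr ⟨c, s, r⟩, t => .inr ⟨c.snoc z, (Fin.snoc s t, r)⟩

theorem continuous_suffixCell_inl (z : X) (c : CubeLabel X PUnit.{1}) :
    Continuous fun q : (Fin c.dim → I) × I => suffixCell z (.inl ⟨c, q.1⟩) q.2 := by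
  refine continuous_inl.comp ((continuous_sigmaMk (ι := CubeLabel X PUnit.{1})
    (i := ⟨c.dim + 1, PUnit.unit, Fin.snoc c.word z⟩)).comp ?_)
  exact continuous_snoc c.dim

theorem continuous_suffixCell_inr (z : X) (c : PrismLabel X PUnit.{1}) :
    Continuous fun q : ((Fin (c.k + 2) → I) × I) × I => suffixCell z (.inr ⟨c, q.1⟩) q.2 := by
  refine continuous_inr.comp ((continuous_sigmaMk (ι := PrismLabel X PUnit.{1})
    (i := c.snoc z)).comp ?_)
  exact ((continuous_snoc (c.k + 2)).comp
    ((continuous_fst.comp continuous_fst).prodMk continuous_snd)).prodMk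
    (continuous_snd.comp continuous_fst)

variable [Quandle X]

theorem faceWord_castSucc_snoc {n : ℕ} (i : Fin (n + 1)) (ε : Bool) (x : Fin (n + 1) → X) (z : X) :
    faceWord i.castSucc ε (Fin.snoc x z : Fin (n + 2) → X) = Fin.snoc (faceWord i ε x) z := by
  funext j
  cases j using Fin.lastCases with
  | last =>
    have : ¬ Fin.last (n + 1) < i.castSucc := not_lt.2 (Fin.le_last _)
    simp [faceWord, this]
  | cast j => simp [faceWord, Fin.castSucc_succAbove_castSucc]

theorem faceWord_last_snoc {n : ℕ} (ε : Bool) (x : Fin n → X) (z : X) :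
    faceWord (Fin.last n) ε (Fin.snoc x z : Fin (n + 1) → X) =
      fun l => if ε = true then z ◃ x l else x l := by
  funext j
  simp [faceWord, Fin.castSucc_lt_last]

/-- The path in the quandle space that traverses the edge labelled by `z` at a point of a cell. -/
def suffixPath (z : X) : Cells X PUnit.{1} → C(I, QuandleSpace X)
  | .inl ⟨c, s⟩ => ContinuousMap.curry
      ⟨_, (QSpace.continuous_mk _).comp (continuous_suffixCell_inl z c)⟩ s
  | .inr ⟨c, s⟩ => ContinuousMap.curry
      ⟨_, (QSpace.continuous_mk _).comp (continuous_suffixCell_inr z c)⟩ s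

theorem suffixPath_apply (z : X) (c : Cells X PUnit.{1}) (t : I) :
    suffixPath z c t = QSpace.mk _ (suffixCell z c t) := by
  rcases c with ⟨c, s⟩ | ⟨c, s⟩ <;> rfl

theorem continuous_suffixPath (z : X) : Continuous (suffixPath z) := by
  refine continuous_sum_dom.2 ⟨continuous_sigma fun c => ?_, continuous_sigma fun c => ?_⟩
  · exact (ContinuousMap.curry
      ⟨_, (QSpace.continuous_mk _).comp (continuous_suffixCell_inl z c)⟩).continuous
  · exact (ContinuousMap.curry
      ⟨_, (QSpace.continuous_mk _).comp (continuous_suffixCell_inr z c)⟩).continuous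

theorem mk_suffixCell_eq (z : X) {c c' : Cells X PUnit.{1}} (h : Glue (QuandleSet.point X) c c')
    (t : I) : QSpace.mk (QuandleSet.point X) (suffixCell z c t) =
      QSpace.mk _ (suffixCell z c' t) := by
  cases h with
  | face y x i ε s =>
    exact glue_face _ _ _ i.castSucc ε _ (coface_castSucc_snoc i ε s t) rfl
      (faceWord_castSucc_snoc i ε x z)
  | bottom c s => exact mk_eq_of_glue (Glue.bottom (c.snoc z) (Fin.snoc s t))
  | side y x p hp j ε q hq h₀ h₁ s r =>
    refine glue_side _ _ _ _ _ j.castSucc ε q.castSucc ?_ ?_ _ r (coface_castSucc_snoc j ε s t) rfl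
      (faceWord_castSucc_snoc j ε x z) _
    · rw [Fin.castSucc_succAbove_castSucc, h₀]
    · rw [Fin.succ_castSucc, Fin.castSucc_succAbove_castSucc, h₁, Fin.succ_castSucc]
  | fold c s r ht =>
    have e : (Fin.snoc (s ∘ Equiv.swap c.pos.castSucc c.pos.succ) t : Fin (c.k + 3) → I) =
        (Fin.snoc s t : Fin (c.k + 3) → I) ∘
          Equiv.swap c.pos.castSucc.castSucc c.pos.castSucc.succ := by
      funext l
      cases l using Fin.lastCases with
      | last =>
        rw [Function.comp_apply, Equiv.swap_apply_of_ne_of_ne, Fin.snoc_last, Fin.snoc_last]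
        · exact (Fin.castSucc_lt_last _).ne'
        · rw [Fin.succ_castSucc]
          exact (Fin.castSucc_lt_last _).ne'
      | cast l =>
        rw [Function.comp_apply, Fin.succ_castSucc,
          ← Function.Injective.map_swap (Fin.castSucc_injective _), Fin.snoc_castSucc,
          Fin.snoc_castSucc]
        rfl
    refine (mk_eq_of_glue (Glue.fold (A := QuandleSet.point X) (c.snoc z) (Fin.snoc s t) r ?_)).trans
      (congrArg (fun w => QSpace.mk (QuandleSet.point X) (.inr ⟨c.snoc z, (w, r)⟩)) e.symm)
    change (Fin.snoc s t : Fin (c.k + 3) → I) c.pos.castSucc.castSucc = 0 ∨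
      (Fin.snoc s t : Fin (c.k + 3) → I) c.pos.castSucc.castSucc = 1
    rwa [Fin.snoc_castSucc]
  | apex c s s' hs =>
    refine mk_eq_of_glue (Glue.apex (A := QuandleSet.point X) (c.snoc z) _ _ ?_)
    intro l (h1 : l ≠ c.pos.castSucc.castSucc) (h2 : l ≠ c.pos.castSucc.succ)
    change Fin (c.k + 2 + 1) at l
    change (Fin.snoc s t : Fin (c.k + 3) → I) l = (Fin.snoc s' t : Fin (c.k + 3) → I) l
    cases l using Fin.lastCases with
    | last => rw [Fin.snoc_last, Fin.snoc_last]
    | cast l =>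
      rw [Fin.snoc_castSucc, Fin.snoc_castSucc]
      refine hs l (fun e => h1 (by rw [e])) fun e => h2 (by rw [e, Fin.succ_castSucc])

/-- The homotopy of the quandle space that moves every point along the edges labelled by `z`. It
starts with the identity and ends with the action of `z`. -/
def suffix (z : X) : C(QuandleSpace X, C(I, QuandleSpace X)) where
  toFun := Quot.lift (suffixPath z) (by
    intro c c' h
    ext t
    rw [suffixPath_apply, suffixPath_apply, mk_suffixCell_eq z h])
  continuous_toFun := continuous_quot_lift _ (continuous_suffixPath z)

theorem suffix_mk (z : X) (c : Cells X PUnit.{1}) (t : I) :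
    suffix z (QSpace.mk _ c) t = QSpace.mk _ (suffixCell z c t) := suffixPath_apply z c t

theorem suffix_zero (z : X) (b : QuandleSpace X) : suffix z b 0 = b := by
  obtain ⟨c, rfl⟩ := Quot.exists_rep b
  refine (suffix_mk z c 0).trans ?_
  rcases c with ⟨c, s⟩ | ⟨c, s, r⟩
  · exact glue_face _ _ _ (Fin.last _) false s (coface_last false s) rfl
      (faceWord_last_snoc false c.word z)
  · exact glue_side _ _ _ _ _ (Fin.last _) false c.pos (by rw [Fin.succAbove_last])
      (by rw [Fin.succAbove_last, Fin.succ_castSucc]) s r (coface_last false s) rfl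
      (faceWord_last_snoc false c.word z) _

theorem suffix_one (z : X) (b : QuandleSpace X) : suffix z b 1 = mapSpace (Inn.gen z) b := by
  obtain ⟨c, rfl⟩ := Quot.exists_rep b
  refine (suffix_mk z c 1).trans ?_
  rcases c with ⟨c, s⟩ | ⟨c, s, r⟩
  · exact glue_face _ _ _ (Fin.last _) true s (coface_last true s) rfl
      (faceWord_last_snoc true c.word z)
  · exact glue_side _ _ _ _ _ (Fin.last _) true c.pos (by rw [Fin.succAbove_last])
      (by rw [Fin.succAbove_last, Fin.succ_castSucc]) s r (coface_last true s) rfl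
      (faceWord_last_snoc true c.word z) _

theorem mk_cube_eq {n : ℕ} {x x' : Fin n → X} {t t' : Fin n → I} (hx : x = x') (ht : t = t') :
    QSpace.mk (QuandleSet.point X) (.inl ⟨⟨n, PUnit.unit, x⟩, t⟩) =
      QSpace.mk _ (.inl ⟨⟨n, PUnit.unit, x'⟩, t'⟩) := by
  subst hx ht
  rfl

theorem mk_prism_eq {k : ℕ} {x x' : Fin (k + 2) → X} (hx : x = x') {p : Fin (k + 1)}
    (h : x p.castSucc = x p.succ) (h' : x' p.castSucc = x' p.succ) (t : (Fin (k + 2) → I) × I) :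
    QSpace.mk (QuandleSet.point X) (.inr ⟨⟨k, PUnit.unit, x, p, h⟩, t⟩) =
      QSpace.mk _ (.inr ⟨⟨k, PUnit.unit, x', p, h'⟩, t⟩) := by
  subst hx
  rfl

theorem map_snoc (g : Inn X) {n : ℕ} (x : Fin n → X) (z : X) :
    (fun l => (g : Equiv.Perm X) ((Fin.snoc x z : Fin (n + 1) → X) l)) =
      Fin.snoc (fun l => (g : Equiv.Perm X) (x l)) ((g : Equiv.Perm X) z) :=
  funext fun l => by cases l using Fin.lastCases <;> simp

theorem mapSpace_suffix (g : Inn X) (z : X) (b : QuandleSpace X) (t : I) :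
    mapSpace g (suffix z b t) = suffix ((g : Equiv.Perm X) z) (mapSpace g b) t := by
  obtain ⟨c, rfl⟩ := Quot.exists_rep b
  refine (congrArg (mapSpace g) (suffix_mk z c t)).trans
    (Eq.trans ?_ (suffix_mk _ (mapCells g c) t).symm)
  rcases c with ⟨c, s⟩ | ⟨c, s, r⟩
  · exact mk_cube_eq (map_snoc g c.word z) rfl
  · exact mk_prism_eq (map_snoc g c.word z) _ _ _

/-- The homotopy `suffix z` at time `t`, as an element of the monoid of self-maps. -/
def suffixEnd (z : X) (t : I) : Function.End (QuandleSpace X) := fun b => suffix z b t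

theorem suffixEnd_zero (z : X) : suffixEnd z 0 = 1 := funext fun b => suffix_zero z b

theorem suffixEnd_comm (z w : X) (t : I) :
    suffixEnd z 1 * suffixEnd w t = suffixEnd (z ◃ w) t * suffixEnd z 1 := by
  funext b
  refine (suffix_one z (suffix w b t)).trans ((mapSpace_suffix (Inn.gen z) w b t).trans ?_)
  rw [← suffix_one]
  rfl

theorem orderedProd_suffixEnd_coface {n : ℕ} (x : Fin (n + 1) → X) (i : Fin (n + 1)) (ε : Bool)
    (t : Fin n → I) (g : Inn X) (b : QuandleSpace X) :
    orderedProd suffixEnd x (coface i ε t) (mapSpace g b) =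
      orderedProd suffixEnd (faceWord i ε x) t
        (mapSpace (faceBase (QuandleSet.inn X) i ε g x) b) := by
  rw [orderedProd_coface suffixEnd_zero suffixEnd_comm]
  cases ε
  · rfl
  · exact congrArg (fun b => orderedProd suffixEnd (faceWord i true x) t b)
      ((suffix_one _ _).trans (mapSpace_mul _ _ b).symm)

theorem continuous_orderedProd_suffixEnd {n : ℕ} (x : Fin n → X) :
    Continuous fun q : (Fin n → I) × QuandleSpace X => orderedProd suffixEnd x q.1 q.2 := by
  induction n with
  | zero => exact continuous_snd
  | succ n ih =>
    have h1 : Continuous fun q : (Fin (n + 1) → I) × QuandleSpace X => suffix (x 0) q.2 (q.1 0) :=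
      continuous_eval.comp (((suffix (x 0)).continuous.comp continuous_snd).prodMk
        ((continuous_apply 0).comp continuous_fst))
    have h2 : Continuous fun q : (Fin (n + 1) → I) × QuandleSpace X => Fin.tail q.1 :=
      continuous_pi fun j => (continuous_apply j.succ).comp continuous_fst
    exact (ih (Fin.tail x)).comp (h2.prodMk h1)

/-- Starting from the vertex, the homotopies `suffix x₁, …, suffix x_n` run through the cube with
the label `(x₁, …, x_n)`. -/
theorem orderedProd_suffixEnd_basePoint {n : ℕ} (x : Fin n → X) (t : Fin n → I) :
    orderedProd suffixEnd x t (basePoint X) =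
      QSpace.mk (QuandleSet.point X) (.inl ⟨⟨n, PUnit.unit, x⟩, t⟩) := by
  induction n with
  | zero => exact mk_cube_eq (Subsingleton.elim _ _) (Subsingleton.elim _ _)
  | succ n ih =>
    rw [orderedProd_last]
    refine (congrArg (suffixEnd (x (Fin.last n)) (t (Fin.last n)))
      (ih (Fin.init x) (Fin.init t))).trans ?_
    refine (suffix_mk _ _ _).trans ?_
    exact mk_cube_eq (Fin.snoc_init_self x) (Fin.snoc_init_self t)

end Suffix

/-! ### The union of the cubes -/

section Height

variable {X : Type u} {Y : Type v} [Quandle X] (A : QuandleSet X Y)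

/-- The radial coordinate of the balls, and `0` on the cubes. -/
def cellHeight : Cells X Y → I
  | .inl _ => 0
  | .inr ⟨_, _, s⟩ => s

/-- The radial coordinate of the balls on the quandle space. It vanishes exactly on the union of
the cubes. -/
def height : C(QSpace A, I) where
  toFun := Quot.lift cellHeight (by
    intro a b h
    cases h <;> rfl)
  continuous_toFun := by
    refine continuous_quot_lift _ (continuous_sum_dom.2 ⟨continuous_const, ?_⟩)
    exact continuous_sigma fun c => continuous_snd

theorem height_projPoint (q : QSpace A) : height _ (projPoint A q) = height A q := by
  obtain ⟨⟨c, t⟩ | ⟨c, t⟩, rfl⟩ := Quot.exists_rep q <;> rfl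

/-- The union of the cubes has the quotient topology. -/
theorem continuousOn_height_eq_zero {Z : Type*} [TopologicalSpace Z] {f : QSpace A → Z}
    (h : ContinuousOn (f ∘ QSpace.mk A) {c | cellHeight c = 0}) :
    ContinuousOn f {q | height A q = 0} := by
  have hK : IsClosed {c : Cells X Y | cellHeight c = 0} :=
    isClosed_eq ((height A).continuous.comp (QSpace.continuous_mk A)) continuous_const
  refine continuousOn_iff_isClosed.2 fun t ht => ⟨f ⁻¹' t ∩ {q | height A q = 0}, ?_, ?_⟩
  · refine (isQuotientMap_mk A).isClosed_preimage.1 ?_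
    rw [Set.preimage_inter, Set.inter_comm]
    exact h.preimage_isClosed_of_isClosed hK ht
  · rw [Set.inter_assoc, Set.inter_self]

theorem height_edgeMap (p : Passage X) (y₀ y₁ : Y) (t : I) :
    height A (edgeMap A p y₀ y₁ t) = 0 := by
  cases p <;> rfl

theorem height_crossMap (p q₀ q₁ : Passage X) (y₀₀ y₀₁ y₁₀ y₁₁ : Y) (t s : I) :
    height A (crossMap A p q₀ q₁ y₀₀ y₀₁ y₁₀ y₁₁ t s) = 0 := by
  cases p <;> cases q₀ <;> cases q₁ <;> rfl

theorem height_tileMap (T : Tile) (S N W E : Passage X) (y₀₀ y₁₀ y₀₁ y₁₁ : Y) (s t : I) :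
    height A (tileMap A T S N W E y₀₀ y₁₀ y₀₁ y₁₁ s t) = 0 := by
  cases T with
  | arcsSWNE =>
    simp only [tileMap]
    split_ifs <;> exact height_edgeMap ..
  | arcsSENW =>
    simp only [tileMap]
    split_ifs <;> exact height_edgeMap ..
  | verticalOver => exact height_crossMap ..
  | horizontalOver => exact height_crossMap ..

theorem height_diagramLoop {D : OrientedLinkDiagram} {C : Coloring D X} {A : QuandleSet X Y}
    (R : RegionColoring C A) (z : Fin 2 → I) : height A (diagramLoop R z) = 0 :=
  height_tileMap ..

end Height

/-! ### Loops act trivially on maps into the union of the cubes -/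

section Translation

variable {X : Type u} [Quandle X] (γ : C(I, QuandleSpace X))

/-- The path `γ` translated by a point of a cube with a label `(g; x₁, …, x_n)`: it is acted on
by `g` and then moved by the homotopies `suffix x₁, …, suffix x_n`. -/
def translateCube (c : CubeLabel X (Inn X)) : C(Fin c.dim → I, C(I, QuandleSpace X)) :=
  ContinuousMap.curry ⟨fun q => orderedProd suffixEnd c.word q.1 (mapSpace c.base (γ q.2)),
    (continuous_orderedProd_suffixEnd c.word).comp
      (continuous_fst.prodMk ((mapSpace c.base).continuous.comp
        (γ.continuous.comp continuous_snd)))⟩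

/-- The path `γ` translated by a point of a cell, where the radial coordinate of the balls is
ignored. -/
def translateCell : Cells X (Inn X) → C(I, QuandleSpace X)
  | .inl ⟨c, t⟩ => translateCube γ c t
  | .inr ⟨c, t, _⟩ => translateCube γ ⟨c.k + 2, c.base, c.word⟩ t

theorem continuous_translateCell : Continuous (translateCell γ) := by
  refine continuous_sum_dom.2 ⟨continuous_sigma fun c => ?_, continuous_sigma fun c => ?_⟩
  · exact (translateCube γ c).continuous
  · exact (translateCube γ ⟨c.k + 2, c.base, c.word⟩).continuous.comp continuous_fst

/-- The homotopies commute at the edges of a folded square, where one of the times is `0` or `1`. This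
makes the translates of a path compatible with the folding. -/
theorem suffixEnd_commute (z : X) {s t : I} (hs : s = 0 ∨ s = 1) :
    Commute (suffixEnd z s) (suffixEnd z t) := by
  rcases hs with rfl | rfl
  · rw [suffixEnd_zero]
    exact .one_left _
  · have := suffixEnd_comm z z t
    rwa [Quandle.fix] at this

theorem translateCell_eq_of_glue {a b : Cells X (Inn X)} (h : Glue (QuandleSet.inn X) a b)
    (ha : cellHeight a = 0) : translateCell γ a = translateCell γ b := by
  cases h with
  | face g x i ε t => exact ContinuousMap.ext fun u => orderedProd_suffixEnd_coface x i ε t g (γ u)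
  | bottom c t => rfl
  | side g x p hp j ε q hq h₀ h₁ t s =>
    exact ContinuousMap.ext fun u => orderedProd_suffixEnd_coface x j ε t g (γ u)
  | fold c t s ht =>
    exact ContinuousMap.ext fun u => congrFun
      (orderedProd_swap c.word c.pos t c.rep (suffixEnd_commute _ ht)).symm _
  | apex c t t' ht => exact absurd ha one_ne_zero

open Classical in
/-- The path `γ` translated by a point in the union of the cubes, with a constant value elsewhere. -/
def translate : QSpace (QuandleSet.inn X) → C(I, QuandleSpace X) :=
  Quot.lift (fun a => if cellHeight a = 0 then translateCell γ a else .const I (basePoint X)) (by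
    intro a b h
    have hh : cellHeight a = cellHeight b := congrArg (height _) (mk_eq_of_glue h)
    by_cases ha : cellHeight a = 0
    · rw [if_pos ha, if_pos (hh.symm.trans ha), translateCell_eq_of_glue γ h ha]
    · rw [if_neg ha, if_neg fun hb => ha (hh.trans hb)])

theorem continuousOn_translate :
    ContinuousOn (translate γ) {q | height (QuandleSet.inn X) q = 0} :=
  continuousOn_height_eq_zero _
    ((continuous_translateCell γ).continuousOn.congr fun _ ha => if_pos ha)

/-- Where the path `γ` is at the vertex, its translate by a point of a cube is this point itself. -/
theorem translate_of_eq_basePoint {u : I} (hu : γ u = basePoint X) {q : QSpace (QuandleSet.inn X)}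
    (hq : height _ q = 0) : translate γ q u = projPoint _ q := by
  have cube : ∀ (c : CubeLabel X (Inn X)) (t : Fin c.dim → I),
      translateCube γ c t u = projPoint (QuandleSet.inn X) (QSpace.mk _ (.inl ⟨c, t⟩)) := by
    intro c t
    change orderedProd suffixEnd c.word t (mapSpace c.base (γ u)) = _
    rw [hu, mapSpace_basePoint, orderedProd_suffixEnd_basePoint]
    rfl
  obtain ⟨a, rfl⟩ := Quot.exists_rep q
  refine (congrArg (fun f : C(I, QuandleSpace X) => f u) (if_pos hq)).trans ?_
  rcases a with ⟨c, t⟩ | ⟨c, t, s⟩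
  · exact cube c t
  · obtain rfl : s = 0 := hq
    exact (cube ⟨c.k + 2, c.base, c.word⟩ t).trans
      (congrArg (projPoint _) (mk_eq_of_glue (Glue.bottom c t)).symm)

theorem translate_vtx (u : I) : translate γ (vtx (QuandleSet.inn X) 1) u = γ u := by
  refine (congrArg (fun f : C(I, QuandleSpace X) => f u) (if_pos rfl)).trans ?_
  exact mapSpace_one (γ u)

/-- The loops in the quandle space act trivially on the classes of maps into the union of the
cubes. -/
theorem baseChange_homotopic_of_height_eq_zero (γ : Path (basePoint X) (basePoint X))
    (f : Ω^ (Fin 2) (QuandleSpace X) (basePoint X)) (hf : ∀ z, height _ (f z) = 0) :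
    GenLoop.Homotopic (baseChange γ f) f := by
  have : Nonempty (Inn X) := ⟨1⟩
  -- the values `g z` of the lift translate `γ`, which gives a free homotopy from `f` to `f`
  obtain ⟨g, hg⟩ := exists_genLoop_lift (isCoveringMap_projPoint (QuandleSet.inn X))
    (vtx (QuandleSet.inn X) 1) f
  have hg' : ∀ z, projPoint _ (g z) = f z := fun z => DFunLike.congr_fun (congrArg Subtype.val hg) z
  have hh : ∀ z, height _ (g z) = 0 := fun z => by rw [← height_projPoint, hg', hf]
  have hc : Continuous fun z => translate γ.toContinuousMap (g z) :=
    (continuousOn_translate _).comp_continuous g.1.continuous hh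
  refine baseChange_homotopic γ f
    ⟨fun q => translate γ.toContinuousMap (g q.2) q.1, ?_⟩ ?_ ?_ ?_
  · exact continuous_eval.comp ((hc.comp continuous_snd).prodMk continuous_fst)
  · exact fun z => (translate_of_eq_basePoint _ γ.source (hh z)).trans (hg' z)
  · exact fun z => (translate_of_eq_basePoint _ γ.target (hh z)).trans (hg' z)
  · intro u z hz
    exact (congrArg (fun q => translate γ.toContinuousMap q u) (g.2 z hz)).trans
      (translate_vtx _ u)

end Translation

/-! ### The action quandle space is path-connected -/

section PathConnected

variable {X : Type u} {Y : Type v} [Quandle X] (A : QuandleSet X Y)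

theorem mk_cube_zero {n : ℕ} (y : Y) (x : Fin n → X) :
    QSpace.mk A (.inl ⟨⟨n, y, x⟩, 0⟩) = vtx A y := by
  induction n with
  | zero =>
    have hx : x = ![] := Subsingleton.elim _ _
    have ht : (0 : Fin 0 → I) = ![] := Subsingleton.elim _ _
    rw [hx, ht]
    rfl
  | succ n ih =>
    rw [← ih (faceWord 0 false x)]
    exact glue_face A y x 0 false 0 (eq_coface_iff.2 ⟨rfl, fun _ => rfl⟩) rfl rfl

theorem joined_zero {n : ℕ} (t : Fin n → I) : Joined t 0 :=
  ⟨⟨⟨fun u l => σ u * t l, by fun_prop⟩, by ext; simp, by ext; simp⟩⟩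

theorem joined_vtx (q : QSpace A) : ∃ y, Joined q (vtx A y) := by
  have cube : ∀ (c : CubeLabel X Y) (t : Fin c.dim → I),
      Joined (QSpace.mk A (.inl ⟨c, t⟩)) (vtx A c.base) := by
    intro c t
    rw [← mk_cube_zero A c.base c.word]
    exact (joined_zero t).map (continuous_cube A c)
  obtain ⟨⟨c, t⟩ | ⟨c, t, s⟩, rfl⟩ := Quot.exists_rep q
  · exact ⟨_, cube c t⟩
  · refine ⟨c.base, Joined.trans ?_ (cube ⟨c.k + 2, c.base, c.word⟩ t)⟩
    have hc : Continuous fun s : I => QSpace.mk A (.inr ⟨c, t, s⟩) :=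
      (QSpace.continuous_mk A).comp (continuous_inr.comp (continuous_sigmaMk.comp (by fun_prop)))
    exact (mk_eq_of_glue (Glue.bottom c t)) ▸ ((joined_zero fun _ : Fin 1 => s).map
      (continuous_apply 0)).map hc

theorem joined_vtx_act (y : Y) (a : X) : Joined (vtx A y) (vtx A (A.act a y)) :=
  ⟨⟨⟨edge A y a, continuous_edge A y a⟩, edge_zero A y a, edge_one A y a⟩⟩

theorem pathConnectedSpace_actionQuandleSpace (hX : IsConnectedQuandle X) (r₀ : X) :
    PathConnectedSpace (ActionQuandleSpace X) := by
  have inn : ∀ g : Inn X, ∀ r : X, Joined (vtx (QuandleSet.regular X) r)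
      (vtx (QuandleSet.regular X) ((g : Equiv.Perm X) r)) := by
    rintro ⟨g, hg⟩
    induction hg using Subgroup.closure_induction with
    | mem g hg =>
      obtain ⟨a, rfl⟩ := hg
      exact fun r => joined_vtx_act (QuandleSet.regular X) r a
    | one => exact fun r => Joined.refl _
    | mul g h _ _ ihg ihh => exact fun r => (ihh r).trans (ihg (h r))
    | inv g _ ih =>
      intro r
      have := ih (g⁻¹ r)
      exact ((congrArg (fun r => Joined _ (vtx (QuandleSet.regular X) r))
        (g.apply_symm_apply r)).mp this).symm
  have base : ∀ q : ActionQuandleSpace X, Joined q (vtx (QuandleSet.regular X) r₀) := by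
    intro q
    obtain ⟨r, hr⟩ := joined_vtx (QuandleSet.regular X) q
    obtain ⟨g, rfl⟩ := hX.exists_smul_eq r r₀
    exact hr.trans (inn g r)
  exact ⟨⟨vtx _ r₀⟩, fun q q' => (base q).trans (base q').symm⟩

end PathConnected

/-! ### Region colorings that extend a coloring -/

section RegionColorings

variable {X : Type u} {Y : Type v} [Quandle X] (A : QuandleSet X Y)

/-- The permutation of the labels that a passage induces. -/
def Passage.perm : Passage X → Equiv.Perm Y
  | .none => 1
  | .along a => A.act a
  | .against a => (A.act a).symm

theorem Passage.acts_iff (p : Passage X) (y₀ y₁ : Y) : p.Acts A y₀ y₁ ↔ y₁ = p.perm A y₀ := by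
  cases p with
  | none => rfl
  | along a => rfl
  | against a => exact eq_comm.trans (Equiv.eq_symm_apply _).symm

theorem Passage.perm_eq_one {p : Passage X} (h : p.sign = 0) : p.perm A = 1 := by
  cases p <;> simp_all [Passage.sign, Passage.perm]

/-- Around a crossing, the region colors of three corners determine the fourth one consistently. -/
theorem crossing_acts {p q₀ q₁ : Passage X} (hq : q₁.sign = q₀.sign) (hu : UnderRule p q₀ q₁)
    {y₀₀ y₀₁ y₁₀ y₁₁ : Y} (h0 : q₀.Acts A y₀₀ y₀₁) (h1 : q₁.Acts A y₁₀ y₁₁)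
    (k0 : p.Acts A y₀₀ y₁₀) : p.Acts A y₀₁ y₁₁ := by
  cases p with
  | none =>
    cases q₀ <;> cases q₁ <;>
      simp_all [Passage.sign, Passage.Acts, UnderRule, Passage.color]
  | along b =>
    change y₁₀ = A.act b y₀₀ at k0
    cases q₀ <;> cases q₁ <;> simp only [Passage.sign, reduceCtorEq] at hq
    · exact h1.trans (k0.trans (congrArg _ h0.symm))
    · obtain rfl : _ = b ◃ _ := hu _ rfl _ rfl
      change y₀₁ = A.act _ y₀₀ at h0
      change y₁₁ = A.act _ y₁₀ at h1
      rw [h1, k0, ← A.act_act, ← h0]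
      rfl
    · obtain rfl : _ = b ◃ _ := hu _ rfl _ rfl
      change y₀₀ = A.act _ y₀₁ at h0
      change y₁₀ = A.act _ y₁₁ at h1
      rw [h1, h0, A.act_act] at k0
      exact (A.act _).injective k0
  | against b =>
    change y₀₀ = A.act b y₁₀ at k0
    cases q₀ <;> cases q₁ <;> simp only [Passage.sign, reduceCtorEq] at hq
    · exact h0.trans (k0.trans (congrArg _ h1.symm))
    · obtain rfl : _ = b ◃ _ := hu _ rfl _ rfl
      change y₀₁ = A.act _ y₀₀ at h0
      change y₁₁ = A.act _ y₁₀ at h1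
      change y₀₁ = A.act b y₁₁
      rw [h0, k0, ← A.act_act, ← h1]
    · obtain rfl : _ = b ◃ _ := hu _ rfl _ rfl
      change y₀₀ = A.act _ y₀₁ at h0
      change y₁₀ = A.act _ y₁₁ at h1
      rw [h1, h0, A.act_act] at k0
      exact (A.act _).injective k0

/-- In a tile, the region coloring rules on the south, west and east sides imply the rule on the
north side. -/
theorem tile_acts {T : Tile} {S N W E : Passage X} {y₀₀ y₁₀ y₀₁ y₁₁ : Y}
    (hc : T.ColorOK S N W E) (hS : S.Acts A y₀₀ y₁₀) (hW : W.Acts A y₀₀ y₀₁)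
    (hE : E.Acts A y₁₀ y₁₁) : N.Acts A y₀₁ y₁₁ := by
  cases T with
  | arcsSWNE =>
    obtain ⟨rfl, rfl⟩ := hc
    rw [Passage.acts_iff] at hS hW
    rwa [hW, ← hS]
  | arcsSENW =>
    obtain ⟨rfl, rfl⟩ := hc
    have rev : ∀ (p : Passage X) (y y' : Y), p.rev.Acts A y y' ↔ p.Acts A y' y := by
      intro p y y'
      cases p
      exacts [eq_comm, Iff.rfl, Iff.rfl]
    rw [rev] at hE ⊢
    rw [Passage.acts_iff] at hS hE
    obtain rfl : y₁₁ = y₀₀ := (S.perm A).injective (hE.symm.trans hS)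
    exact hW
  | verticalOver =>
    obtain ⟨rfl, h2, h3⟩ := hc
    exact crossing_acts A h2 h3 hW hE hS
  | horizontalOver =>
    obtain ⟨rfl, h2, h3⟩ := hc
    have := crossing_acts A h2 h3 hS ((Passage.acts_iff A N y₀₁ _).2 rfl) hW
    rw [Passage.acts_iff] at this hE ⊢
    exact hE.trans this.symm

variable {A} {D : OrientedLinkDiagram} (C : Coloring D X)

/-- The labels of a region coloring with outer color `r`: the label is `r` on the bottom side, and
it is transported upwards along the columns of the grid. -/
def columnLabel (A : QuandleSet X Y) (r : Y) (i : Fin (D.m + 2)) (j : Fin (D.n + 2)) : Y :=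
  Fin.induction (motive := fun _ => Y) r (fun j y => (C.v i j).perm A y) j

/-- The region coloring with a given outer color. -/
def RegionColoring.ofOuter (A : QuandleSet X Y) (r : Y) : RegionColoring C A where
  label := columnLabel C A r
  v_rule i j := (Passage.acts_iff A _ _ _).2 (Fin.induction_succ ..)
  h_rule i j := by
    induction j using Fin.induction with
    | zero =>
      rw [Passage.acts_iff, Passage.perm_eq_one]
      · rfl
      · rw [C.h_sign, D.bottom_empty]
        rfl
    | succ j ih =>
      exact tile_acts A (C.tile_rule i j) ih ((Passage.acts_iff A _ _ _).2 (Fin.induction_succ ..))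
        ((Passage.acts_iff A _ _ _).2 (Fin.induction_succ ..))

theorem RegionColoring.outer_injective :
    Function.Injective (RegionColoring.outer : RegionColoring C A → Y) := by
  intro R R' h
  have bottom : ∀ i, R.label i 0 = R'.label i 0 := fun i =>
    (label_boundary R i 0 (.inr (.inr (.inl rfl)))).trans
      (h.trans (label_boundary R' i 0 (.inr (.inr (.inl rfl)))).symm)
  refine RegionColoring.ext (funext fun i => funext fun j => ?_)
  induction j using Fin.induction with
  | zero => exact bottom i
  | succ j ih =>
    rw [(Passage.acts_iff A _ _ _).1 (R.v_rule i j), (Passage.acts_iff A _ _ _).1 (R'.v_rule i j),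
      ih]

/-- A region coloring is determined by the color of the outer region, which is arbitrary. -/
def RegionColoring.outerEquiv (A : QuandleSet X Y) : RegionColoring C A ≃ Y :=
  Equiv.ofBijective RegionColoring.outer
    ⟨RegionColoring.outer_injective C, fun r => ⟨RegionColoring.ofOuter C A r, rfl⟩⟩

end RegionColorings

/-! ### The invariants -/

section Invariants

variable {X : Type u} [Quandle X]

theorem proj_edgeMap (p : Passage X) (y₀ y₁ : X) (t : I) :
    proj X (edgeMap (QuandleSet.regular X) p y₀ y₁ t) =
      edgeMap (QuandleSet.point X) p PUnit.unit PUnit.unit t := by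
  cases p <;> rfl

theorem proj_crossMap (p q₀ q₁ : Passage X) (y₀₀ y₀₁ y₁₀ y₁₁ : X) (t s : I) :
    proj X (crossMap (QuandleSet.regular X) p q₀ q₁ y₀₀ y₀₁ y₁₀ y₁₁ t s) =
      crossMap (QuandleSet.point X) p q₀ q₁ PUnit.unit PUnit.unit PUnit.unit PUnit.unit t s := by
  cases p <;> cases q₀ <;> cases q₁ <;> rfl

theorem proj_tileMap (T : Tile) (S N W E : Passage X) (y₀₀ y₁₀ y₀₁ y₁₁ : X) (s t : I) :
    proj X (tileMap (QuandleSet.regular X) T S N W E y₀₀ y₁₀ y₀₁ y₁₁ s t) =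
      tileMap (QuandleSet.point X) T S N W E PUnit.unit PUnit.unit PUnit.unit PUnit.unit s t := by
  cases T with
  | arcsSWNE =>
    simp only [tileMap]
    split_ifs <;> exact proj_edgeMap ..
  | arcsSENW =>
    simp only [tileMap]
    split_ifs <;> exact proj_edgeMap ..
  | verticalOver => exact proj_crossMap ..
  | horizontalOver => exact proj_crossMap ..

theorem mapLoop_proj_diagramLoop {D : OrientedLinkDiagram} {C : Coloring D X}
    (R : RegionColoring C (QuandleSet.regular X)) :
    mapLoop (proj X) (diagramLoop R) = diagramLoop (RegionColoring.trivial C) :=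
  Subtype.ext (ContinuousMap.ext fun _ => proj_tileMap ..)

theorem isCoveringMap_proj [Nonempty X] : IsCoveringMap (proj X) := by
  rw [← projPoint_regular]
  exact isCoveringMap_projPoint _

/-- The class of a shadow colored diagram projects to the class of the colored diagram, whatever
path is used for the change of the base point. -/
theorem mapLoop_proj_baseChange_homotopic {D : OrientedLinkDiagram} {C : Coloring D X}
    (R : RegionColoring C (QuandleSet.regular X)) {r₀ : X}
    (γ : Path (vtx (QuandleSet.regular X) R.outer) (vtx (QuandleSet.regular X) r₀)) :
    GenLoop.Homotopic (x := basePoint X) (mapLoop (proj X) (baseChange γ (diagramLoop R)))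
      (diagramLoop (RegionColoring.trivial C)) := by
  rw [mapLoop_baseChange, mapLoop_proj_diagramLoop]
  exact baseChange_homotopic_of_height_eq_zero (γ.map (proj X).continuous) _
    (height_diagramLoop _)

theorem mapDomain_shadowHomotopyInvariant [Finite X] (r₀ : X)
    (Φ : π_ 2 (ActionQuandleSpace X) (vtx (QuandleSet.regular X) r₀) ≃*
      π_ 2 (QuandleSpace X) (basePoint X))
    (hΦ : ∀ f : Ω^ (Fin 2) (ActionQuandleSpace X) (vtx (QuandleSet.regular X) r₀),
      Φ ⟦f⟧ = ⟦mapLoop (proj X) f⟧)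
    (D : OrientedLinkDiagram)
    (γ : ∀ r : X, Path (vtx (QuandleSet.regular X) r) (vtx (QuandleSet.regular X) r₀)) :
    MonoidAlgebra.mapDomainRingEquiv ℤ Φ (shadowHomotopyInvariant X D r₀ γ) =
      Nat.card X • quandleHomotopyInvariant X D := by
  have : Fintype X := Fintype.ofFinite X
  let ξ : Coloring D X → π_ 2 (QuandleSpace X) (basePoint X) := fun C =>
    ⟦diagramLoop (RegionColoring.trivial C)⟧
  let ψ : ShadowColoring D X → π_ 2 (ActionQuandleSpace X) (vtx (QuandleSet.regular X) r₀) :=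
    fun C => ⟦baseChange (γ C.2.outer) (diagramLoop C.2)⟧
  have hψ : ∀ C, Φ (ψ C) = ξ C.1 := fun C =>
    (hΦ _).trans (Quotient.sound (mapLoop_proj_baseChange_homotopic C.2 _))
  -- the shadow colorings are indexed by a coloring and the color of the outer region
  let e : ShadowColoring D X ≃ Coloring D X × X :=
    (Equiv.sigmaCongrRight fun C => RegionColoring.outerEquiv C (QuandleSet.regular X)).trans
      (Equiv.sigmaEquivProd _ _)
  change MonoidAlgebra.mapDomainRingEquiv ℤ Φ (∑ C, MonoidAlgebra.single (ψ C) 1) =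
    Nat.card X • ∑ C, MonoidAlgebra.single (ξ C) 1
  simp only [map_sum, MonoidAlgebra.mapDomainRingEquiv_single, hψ]
  refine (Fintype.sum_equiv e _
    (fun q : Coloring D X × X => MonoidAlgebra.single (ξ q.1) (1 : ℤ)) fun _ => rfl).trans ?_
  rw [Fintype.sum_prod_type, Finset.smul_sum]
  simp only [Finset.sum_const, Finset.card_univ, Nat.card_eq_fintype_card]

end Invariants

end QuandleHomotopy

end

theorem theorem3p2 {X : Type*} [Quandle X] [Finite X]
    (hX : QuandleHomotopy.IsConnectedQuandle X) (r₀ : X) :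
    PathConnectedSpace (QuandleHomotopy.ActionQuandleSpace X) ∧
    IsCoveringMap (QuandleHomotopy.proj X) ∧
    ∃ Φ : π_ 2 (QuandleHomotopy.ActionQuandleSpace X)
          (QuandleHomotopy.vtx (QuandleHomotopy.QuandleSet.regular X) r₀) ≃*
        π_ 2 (QuandleHomotopy.QuandleSpace X) (QuandleHomotopy.basePoint X),
      (∀ f : Ω^ (Fin 2) (QuandleHomotopy.ActionQuandleSpace X)
          (QuandleHomotopy.vtx (QuandleHomotopy.QuandleSet.regular X) r₀),
        Φ ⟦f⟧ = ⟦QuandleHomotopy.mapLoop (QuandleHomotopy.proj X) f⟧) ∧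
      ∀ (D : QuandleHomotopy.OrientedLinkDiagram)
        (γ : ∀ r : X, Path (QuandleHomotopy.vtx (QuandleHomotopy.QuandleSet.regular X) r)
          (QuandleHomotopy.vtx (QuandleHomotopy.QuandleSet.regular X) r₀)),
        MonoidAlgebra.mapDomainRingEquiv ℤ Φ
            (QuandleHomotopy.shadowHomotopyInvariant X D r₀ γ) =
          Nat.card X • QuandleHomotopy.quandleHomotopyInvariant X D := by
  have : Nonempty X := ⟨r₀⟩
  refine ⟨QuandleHomotopy.pathConnectedSpace_actionQuandleSpace hX r₀,
    QuandleHomotopy.isCoveringMap_proj,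
    QuandleHomotopy.piTwoEquiv QuandleHomotopy.isCoveringMap_proj _, fun f => rfl, fun D γ => ?_⟩
  exact QuandleHomotopy.mapDomain_shadowHomotopyInvariant r₀ _ (fun f => rfl) D γ
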